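/- Let $X$ be a smooth geometrically irreducible projective curve over $\mathbb{Q}$ and let $t\in\mathbb{Q}(X)$ be a non-constant rational function. Fix an algebraic closure $\overline{\mathbb{Q}}$. Let $F(T)\in\mathbb{Z}[T]$ be the primitive separable polynomial (unique up to sign) whose roots are exactly the finite critical values of $t$, that is, the $\alpha\in\overline{\mathbb{Q}}$ for which $t-\alpha$ has a multiple zero in $X(\overline{\mathbb{Q}})$, and let $\Delta_F$ be the discriminant of $F$. Let $\mathcal{P}_F$ be the set of primes $p\nmid\Delta_F$ such that $F$ has a root modulo $p$, and let $\mathcal{M}_F$ be the set of square-free positive integers all of whose prime divisors belong to $\mathcal{P}_F$. For a positive integer $m$ let $\omega(m)$ be the number of prime divisors of $m$ and $p_{\min}(m)$ the smallest of them (with $p_{\min}(1)=1$). For a positive integer $n$ let $K_n=\mathbb{Q}(t^{-1}(n))\subset\overline{\mathbb{Q}}$ be the field generated over $\mathbb{Q}$ by all points of the fiber $t^{-1}(n)\subset X(\overline{\mathbb{Q}})$. Call $m\in\mathcal{M}_F$ primitive for $n$ if every prime $p\mid m$ ramifies in $K_n$ and for every positive integer $n'<n$ some prime $p\mid m$ does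 not ramify in $K_{n'}$. Then there exists $p_0=p_0(X,t)$ such that every $m\in\mathcal{M}_F$ which satisfies $p_{\min}(m)>\omega(m)$ and all of whose prime divisors are at least $p_0$ is primitive for some positive integer $n\le m(\omega(m)+1)$. -/

import Mathlib

open CategoryTheory AlgebraicGeometry TensorProduct

noncomputable section

namespace Diversity

/-- The fixed algebraic closure of `ℚ`. -/
abbrev Qbar : Type := AlgebraicClosure ℚ

/-- A curve over `ℚ`: a smooth, geometrically irreducible, proper scheme of dimension one over `ℚ`
(a proper curve over a field is automatically projective, and `X` is automatically integral). -/
structure IsCurve {X : Scheme.{0}} (π : X ⟶ Spec (.of ℚ)) : Prop where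
  smooth : SmoothOfRelativeDimension 1 π
  proper : IsProper π
  geometricallyIrreducible : GeometricallyIrreducible π

section Points

variable {X : Scheme.{0}}

/-- `X(Qbar)`: morphisms `Spec Qbar ⟶ X` over `ℚ`. -/
def GeomPoint (π : X ⟶ Spec (.of ℚ)) : Type :=
  {P : Spec (.of Qbar) ⟶ X // P ≫ π = Spec.map (CommRingCat.ofHom (algebraMap ℚ Qbar))}

variable {π : X ⟶ Spec (.of ℚ)}

/-- The underlying (scheme-theoretic) point of `X`. -/
def GeomPoint.pt (P : GeomPoint π) : X := P.1 (IsLocalRing.closedPoint Qbar)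

/-- The local ring of `X` at the point underlying `P`. -/
abbrev GeomPoint.localRing (P : GeomPoint π) : Type := X.presheaf.stalk P.pt

/-- Evaluation at `P` of the functions that are regular at `P`. -/
def GeomPoint.eval (P : GeomPoint π) : P.localRing →+* Qbar :=
  (Scheme.stalkClosedPointTo P.1).hom

/-- The field of definition `ℚ(P)`, i.e. the image of the residue field of `P` in `Qbar`. -/
def GeomPoint.field (P : GeomPoint π) : IntermediateField ℚ Qbar :=
  IntermediateField.adjoin ℚ (Set.range P.eval)

/-- The `Qbar`-linear evaluation `Qbar ⊗ O_{X,P} → Qbar`. The localization of the source at the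
kernel is the local ring at `P` of the base change of `X` to `Qbar`. (The tensor product over `ℤ`
is the one over `ℚ`, since both factors are `ℚ`-algebras.) -/
def GeomPoint.geomEval (P : GeomPoint π) : Qbar ⊗[ℤ] P.localRing →ₐ[ℤ] Qbar :=
  Algebra.TensorProduct.lift (AlgHom.id ℤ Qbar) P.eval.toIntAlgHom fun _ _ => Commute.all _ _

/-- The fiber `t⁻¹(a) ⊆ X(Qbar)` of a rational function `t` over a finite value `a`: the points at
which `t` is regular and takes the value `a`. -/
def fiber [IsIntegral X] (π : X ⟶ Spec (.of ℚ)) (t : X.functionField) (a : Qbar) :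
    Set (GeomPoint π) :=
  {P | ∃ s : P.localRing, algebraMap P.localRing X.functionField s = t ∧ P.eval s = a}

/-- `t - a` has a multiple zero at `P`: `t` is regular at `P` and `t - a` belongs to the square of
the maximal ideal of the point `P` of the base change of `X` to `Qbar`. (That square is a primary
ideal, hence belonging to it can be tested before localizing.) -/
def HasMultipleZero [IsIntegral X] (t : X.functionField) (a : Qbar) (P : GeomPoint π) : Prop :=
  ∃ s : P.localRing, algebraMap P.localRing X.functionField s = t ∧
    (1 : Qbar) ⊗ₜ[ℤ] s - a ⊗ₜ[ℤ] (1 : P.localRing) ∈ (RingHom.ker P.geomEval) ^ 2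

/-- The finite critical values of `t`. -/
def finiteCriticalValues [IsIntegral X] (π : X ⟶ Spec (.of ℚ)) (t : X.functionField) : Set Qbar :=
  {a | ∃ P : GeomPoint π, HasMultipleZero t a P}

/-- `K_n = ℚ(t⁻¹(n))`, the field generated by all points of the fiber over `n`. -/
def fiberField [IsIntegral X] (π : X ⟶ Spec (.of ℚ)) (t : X.functionField) (n : ℕ) :
    IntermediateField ℚ Qbar :=
  ⨆ P ∈ fiber π t (n : Qbar), GeomPoint.field P

/-- `F` is a primitive separable polynomial whose roots are exactly the finite critical values
of `t` (this determines `F` up to sign). -/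
structure IsCriticalPolynomial [IsIntegral X] (π : X ⟶ Spec (.of ℚ)) (t : X.functionField)
    (F : Polynomial ℤ) : Prop where
  primitive : F.IsPrimitive
  separable : (F.map (Int.castRingHom ℚ)).Separable
  roots : {a : Qbar | F.eval₂ (Int.castRingHom Qbar) a = 0} = finiteCriticalValues π t

end Points

/-- The set `P_F` of primes `p` such that `F` has a root mod `p` and `p` does not divide the
discriminant of `F`. -/
def primeSet (F : Polynomial ℤ) : Set ℕ :=
  {p | p.Prime ∧ (∃ a : ℤ, (p : ℤ) ∣ F.eval a) ∧ ¬ (p : ℤ) ∣ F.discr}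

/-- The set `M_F` of square-free positive integers composed of primes from `P_F`. -/
def squarefreeSet (F : Polynomial ℤ) : Set ℕ :=
  {m | Squarefree m ∧ ∀ p : ℕ, p.Prime → p ∣ m → p ∈ primeSet F}

/-- The prime `p` ramifies in `K`: some prime ideal of the ring of integers of `K` occurs in `(p)`
with exponent at least `2`. -/
def Ramifies (p : ℕ) (K : Type*) [Field K] : Prop :=
  ∃ I : Ideal (NumberField.RingOfIntegers K),
    I.IsPrime ∧ (p : NumberField.RingOfIntegers K) ∈ I ^ 2

/-- `m` is primitive for the positive integer `n`: every prime `p ∣ m` ramifies in `K_n`, and for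
every positive `n' < n` some prime `p ∣ m` does not ramify in `K_{n'}`. -/
def IsPrimitiveFor {X : Scheme.{0}} [IsIntegral X] (π : X ⟶ Spec (.of ℚ)) (t : X.functionField)
    (m n : ℕ) : Prop :=
  (∀ p : ℕ, p.Prime → p ∣ m → Ramifies p (fiberField π t n)) ∧
    ∀ n' : ℕ, 1 ≤ n' → n' < n →
      ∃ p : ℕ, p.Prime ∧ p ∣ m ∧ ¬ Ramifies p (fiberField π t n')

end Diversity

end

/-!
Let `n` be an integer and let `p` be a large prime with `p ∥ F(n)`. The heart of the proof is that
`p` ramifies in `K_n = ℚ(t⁻¹(n))` (`Diversity.exists_ramifies_of_isCriticalPolynomial`). Since `F`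
is primitive, some nonconstant irreducible factor `g` of `F` satisfies `p ∥ g(n)`. Its roots are
critical values; let `a = t(P)` be one of them, with `t - a` having a multiple zero at `P`.

* On an affine neighbourhood of `P` with coordinate ring `A`, the function `g(t)` lies in the
  square of the kernel of the evaluation `A → Qbar` at `P`. The multiple zero is given on the base
  change to `Qbar`; it descends because the residue field of `P` is formally étale over `ℚ`
  (`Diversity.mem_ker_sq_of_one_tmul_mem`).
* The curve is spread out to a two-dimensional domain `A₀ = ℤ[S]` with `A₀ ⊗ ℚ = A`. As `p ∣
  g(n)`, there is a place of `Qbar` over `p` at which `a ≡ n`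
  (`Diversity.exists_valuationSubring_of_dvd_eval`). The point `P` is integral there, so it
  reduces to a prime `q` of `A₀` that contains `p` and `t - n`. By Krull's principal ideal theorem
  some prime `r ⊆ q` contains `t - n` but not `p` (`Diversity.exists_ringHom_ker_le`): `q` has
  height two, and modulo a prime that contains both `p` and `t - n` the ring is a finite field, as
  `A` is algebraic over `ℚ(t)`. Thus `A₀ ⧸ r` embeds into `Qbar`, and gives a point `φ` of the
  fiber over `n` with the same reduction as `P`.
* Now `g(t) ∈ q ^ 2`, so in the field of definition of `φ` the integer `g(n)` lies in the square
  of a prime ideal over `p`. Since `p ∥ g(n)`, so does `p` itself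
  (`Diversity.ramifies_of_map_mem_sq`).

That `A` is algebraic over `ℚ(t)` comes from the smoothness of the curve: the module of
differentials of its function field is one-dimensional and generated by `dt`
(`Diversity.isAlgebraic_adjoin_of_rank_kaehlerDifferential_eq_one`).

It remains to find `n ≤ m (ω(m) + 1)` such that `p ∥ F(n)` for all `p ∣ m`
(`Diversity.exists_forall_prime_dvd_eval_not_sq_dvd`). The Chinese remainder theorem gives `1 ≤ n₀
≤ m` such that all primes `p ∣ m` divide `F(n₀)`. These are simple roots, and the primes exceed
`ω(m)`, so each `p ∣ m` has `p ^ 2 ∣ F(n₀ + j m)` for at most one `j ≤ ω(m)`, and some `j` is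
left. The least `n` at which all primes dividing `m` ramify is then as required.
-/

namespace Diversity

/-! ### Differentials -/

section

theorem eq_zero_of_one_tmul_eq_zero {E L M : Type*} [Field E] [Field L] [Algebra E L]
    [AddCommGroup M] [Module E M] {x : M} (hx : (1 : L) ⊗ₜ[E] x = 0) : x = 0 :=
  Module.FaithfullyFlat.tensorProduct_mk_injective (A := E) (B := L) M
    (by simpa using hx)

/-- In characteristic zero, a field whose module of differentials over `k` has rank one is
algebraic over the subfield generated by any transcendental element. -/
theorem isAlgebraic_adjoin_of_rank_kaehlerDifferential_eq_one {k L : Type*} [Field k] [CharZero k]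
    [Field L] [Algebra k L] [Algebra.EssFiniteType k L]
    (hrank : Module.rank L (Ω[L⁄k]) = 1) {t : L} (ht : Transcendental k t) :
    Algebra.IsAlgebraic (IntermediateField.adjoin k {t}) L := by
  set E := IntermediateField.adjoin k {t} with hE
  have : CharZero E := charZero_of_injective_algebraMap (algebraMap k E).injective
  have : Algebra.EssFiniteType E L := Algebra.EssFiniteType.of_comp k E L
  have : Algebra.EssFiniteType k E := by
    rw [IntermediateField.essFiniteType_iff]
    exact ⟨{t}, by simp [hE]⟩
  -- otherwise all differentials of `k(t)` would vanish, and `t` would be algebraic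
  have hDt : KaehlerDifferential.D k L t ≠ 0 := by
    intro h0
    -- `E → L` is formally smooth, so differentials of `E` are not killed in `L`
    have hinj : Function.Injective (KaehlerDifferential.mapBaseChange k E L) := by
      have hex := Algebra.H1Cotangent.exact_δ_mapBaseChange k E L
      rw [injective_iff_map_eq_zero]
      intro x hx
      obtain ⟨y, rfl⟩ := (hex x).1 hx
      rw [Subsingleton.elim y 0, map_zero]
    let tE : E := ⟨t, IntermediateField.subset_adjoin k {t} rfl⟩
    have h1 : KaehlerDifferential.D k E tE = 0 := by
      have h2 : (1 : L) ⊗ₜ[E] KaehlerDifferential.D k E tE = 0 := by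
        apply hinj
        rw [map_zero, KaehlerDifferential.mapBaseChange_tmul, one_smul,
          KaehlerDifferential.map_D]
        exact h0
      exact eq_zero_of_one_tmul_eq_zero h2
    have h3 : ∀ (x : L) (hx : x ∈ E), KaehlerDifferential.D k E ⟨x, hx⟩ = 0 := by
      intro x hx
      induction hx using IntermediateField.adjoin_induction with
      | mem x hx => obtain rfl : x = t := hx; exact h1
      | algebraMap x => exact (KaehlerDifferential.D k E).map_algebraMap x
      | add x y hx hy h h' =>
        have := (KaehlerDifferential.D k E).map_add ⟨x, hx⟩ ⟨y, hy⟩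
        rw [h, h', add_zero] at this
        exact this
      | inv x hx h =>
        have := (KaehlerDifferential.D k E).leibniz_inv ⟨x, hx⟩
        rw [h, smul_zero] at this
        exact this
      | mul x y hx hy h h' =>
        have := (KaehlerDifferential.D k E).leibniz ⟨x, hx⟩ ⟨y, hy⟩
        rw [h, h', smul_zero, smul_zero, add_zero] at this
        exact this
    have : Algebra.FormallyUnramified k E := by
      refine ⟨⟨fun a b => ?_⟩⟩
      have htop := KaehlerDifferential.span_range_derivation k E
      have hbot : Submodule.span E (Set.range (KaehlerDifferential.D k E)) = ⊥ := by
        rw [Submodule.span_eq_bot]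
        rintro _ ⟨⟨x, hx⟩, rfl⟩
        exact h3 x hx
      rw [hbot] at htop
      have key : ∀ c : Ω[E⁄k], c = 0 := fun c => by
        have : c ∈ (⊤ : Submodule E (Ω[E⁄k])) := trivial
        rwa [← htop, Submodule.mem_bot] at this
      rw [key a, key b]
    have := Algebra.FormallyUnramified.isSeparable k E
    have h4 : IsAlgebraic k tE := Algebra.IsAlgebraic.isAlgebraic tE
    exact ht (h4.algebraMap (A := L))
  have : Algebra.FormallyUnramified E L := by
    refine ⟨⟨fun a b => ?_⟩⟩
    have htop := KaehlerDifferential.span_range_derivation E L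
    have hbot : Submodule.span L (Set.range (KaehlerDifferential.D E L)) = ⊥ := by
      rw [Submodule.span_eq_bot]
      rintro _ ⟨x, rfl⟩
      obtain ⟨c, hc⟩ : ∃ c : L, c • KaehlerDifferential.D k L t = KaehlerDifferential.D k L x :=
        (finrank_eq_one_iff_of_nonzero' _ hDt).1
          (Module.rank_eq_one_iff_finrank_eq_one.1 hrank) _
      have h5 := congrArg (KaehlerDifferential.map k E L L) hc
      rw [map_smul, KaehlerDifferential.map_D, KaehlerDifferential.map_D] at h5
      have h6 : KaehlerDifferential.D E L t = 0 :=
        (KaehlerDifferential.D E L).map_algebraMap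
          (⟨t, IntermediateField.subset_adjoin k {t} rfl⟩ : E)
      simpa [h6] using h5.symm
    rw [hbot] at htop
    have key : ∀ c : Ω[L⁄E], c = 0 := fun c => by
      have : c ∈ (⊤ : Submodule L (Ω[L⁄E])) := trivial
      rwa [← htop, Submodule.mem_bot] at this
    rw [key a, key b]
  have := Algebra.FormallyUnramified.isSeparable E L
  infer_instance

/-- If `1 ⊗ z` lies in the square of the kernel of the evaluation `Ω ⊗ A → Ω`, then `z` lies in the
square of the kernel `𝔪` of `A → Ω`. The residue field of `𝔪` is formally étale over `ℚ`, so it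
lifts to `A ⧸ 𝔪 ^ 2`, and a `z` outside `𝔪 ^ 2` would be detected by a derivation of `A` with
values in the residue field; that derivation extends `Ω`-linearly. -/
theorem mem_ker_sq_of_one_tmul_mem {A Ω : Type*} [CommRing A] [Algebra ℚ A] [Field Ω]
    [Algebra ℚ Ω] [Algebra.IsAlgebraic ℚ Ω] (ev : A →+* Ω)
    (geomEv : Ω ⊗[ℤ] A →+* Ω) (hev : ∀ c x, geomEv (c ⊗ₜ x) = c * ev x) {z : A}
    (hz : (1 : Ω) ⊗ₜ[ℤ] z ∈ RingHom.ker geomEv ^ 2) : z ∈ RingHom.ker ev ^ 2 := by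
  set m := RingHom.ker ev with hm
  have : m.IsPrime := RingHom.ker_isPrime ev
  let ι : A ⧸ m →ₐ[ℚ] Ω := (RingHom.kerLift ev).toRatAlgHom
  have hι : Function.Injective ι := RingHom.kerLift_injective ev
  have hιmk : ∀ x, ι (Ideal.Quotient.mk m x) = ev x := fun x => RingHom.kerLift_mk ev x
  have : Algebra.IsAlgebraic ℚ (A ⧸ m) := Algebra.IsAlgebraic.of_injective ι hι
  have hfield : IsField (A ⧸ m) :=
    isField_of_isIntegral_of_isField' (R := ℚ) (Semifield.toIsField ℚ)
  let _ : Field (A ⧸ m) :=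
    letI : m.IsMaximal := Ideal.Quotient.maximal_of_isField m hfield
    Ideal.Quotient.field m
  have : Algebra.FormallyEtale ℚ (A ⧸ m) := Algebra.FormallyEtale.of_isSeparable ℚ (A ⧸ m)
  have hle : m ^ 2 ≤ m := Ideal.pow_le_self two_ne_zero
  let g : A ⧸ m ^ 2 →ₐ[ℚ] A ⧸ m := Ideal.Quotient.factorₐ ℚ hle
  have hg : Function.Surjective g := Ideal.Quotient.factor_surjective hle
  have hgmk : ∀ x, g (Ideal.Quotient.mk _ x) = Ideal.Quotient.mk m x := fun x => rfl
  have hker : ∀ x y, g x = 0 → g y = 0 → x * y = 0 := by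
    intro x y hx hy
    obtain ⟨x, rfl⟩ := Ideal.Quotient.mk_surjective x
    obtain ⟨y, rfl⟩ := Ideal.Quotient.mk_surjective y
    rw [hgmk, Ideal.Quotient.eq_zero_iff_mem] at hx hy
    rw [← map_mul, Ideal.Quotient.eq_zero_iff_mem, pow_two]
    exact Ideal.mul_mem_mul hx hy
  have hnil : IsNilpotent (RingHom.ker (g : A ⧸ m ^ 2 →+* A ⧸ m)) := by
    refine ⟨2, (pow_two _).trans ?_⟩
    rw [Ideal.zero_eq_bot, eq_bot_iff, Ideal.mul_le]
    exact fun x hx y hy => hker x y hx hy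
  -- `σ` makes `A ⧸ m ^ 2` a vector space over the residue field
  let σ : A ⧸ m →ₐ[ℚ] A ⧸ m ^ 2 :=
    Algebra.FormallySmooth.liftOfSurjective (AlgHom.id ℚ _) g hg hnil
  have hσ : ∀ x, g (σ x) = x := Algebra.FormallySmooth.liftOfSurjective_apply _ g hg hnil
  by_contra hzm
  have hz0 : ev z = 0 := by
    have h1 : (1 : Ω) ⊗ₜ[ℤ] z ∈ RingHom.ker geomEv := Ideal.pow_le_self two_ne_zero hz
    rwa [RingHom.mem_ker, hev, one_mul] at h1
  have hw : Ideal.Quotient.mk (m ^ 2) z ≠ 0 := by rwa [Ne, Ideal.Quotient.eq_zero_iff_mem]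
  let _ : Algebra (A ⧸ m) (A ⧸ m ^ 2) := σ.toRingHom.toAlgebra
  obtain ⟨l, hl⟩ : ∃ l : Module.Dual (A ⧸ m) (A ⧸ m ^ 2), l (Ideal.Quotient.mk (m ^ 2) z) ≠ 0 := by
    by_contra! h
    exact hw ((Module.forall_dual_apply_eq_zero_iff (A ⧸ m) _).1 h)
  -- `r` is the derivation `x ↦ x - x(P)` modulo `m ^ 2`, which fixes the class of `z`
  let r : A →+ A ⧸ m ^ 2 :=
    (Ideal.Quotient.mk (m ^ 2)).toAddMonoidHom -
      (σ.toRingHom.comp (Ideal.Quotient.mk m)).toAddMonoidHom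
  have hr : ∀ x, r x = Ideal.Quotient.mk (m ^ 2) x - σ (Ideal.Quotient.mk m x) := fun x => rfl
  have hgr : ∀ x, g (r x) = 0 := fun x => by rw [hr, map_sub, hσ, hgmk, sub_self]
  have hrmul : ∀ x y, r (x * y) = Ideal.Quotient.mk m x • r y + Ideal.Quotient.mk m y • r x := by
    intro x y
    have h1 := hker _ _ (hgr x) (hgr y)
    rw [hr, hr] at h1
    simp only [Algebra.smul_def, RingHom.algebraMap_toAlgebra, hr, map_mul,
      AlgHom.toRingHom_eq_coe, RingHom.coe_coe]
    linear_combination h1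
  let δ : A →+ Ω := ι.toRingHom.toAddMonoidHom.comp (l.toAddMonoidHom.comp r)
  have hδ : ∀ x, δ x = ι (l (r x)) := fun x => rfl
  have hδmul : ∀ x y, δ (x * y) = ev x * δ y + ev y * δ x := by
    intro x y
    simp only [hδ, hrmul, map_add, map_smul, smul_eq_mul, map_mul, hιmk]
  let D : Ω ⊗[ℤ] A →ₗ[ℤ] Ω := TensorProduct.lift ((LinearMap.mul ℤ Ω).compl₂ δ.toIntLinearMap)
  have hD : ∀ c x, D (c ⊗ₜ x) = c * δ x := fun c x => rfl
  have hDmul : ∀ u v, D (u * v) = geomEv u * D v + geomEv v * D u := by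
    intro u v
    induction u using TensorProduct.induction_on with
    | zero => simp
    | add a b ha hb => simp only [add_mul, map_add, ha, hb]; ring
    | tmul c x =>
      induction v using TensorProduct.induction_on with
      | zero => simp
      | add a b ha hb => simp only [mul_add, map_add, ha, hb]; ring
      | tmul d y =>
        simp only [Algebra.TensorProduct.tmul_mul_tmul, hD, hev, hδmul]
        ring
  have hDz : D (1 ⊗ₜ z) = 0 := by
    rw [pow_two] at hz
    generalize (1 : Ω) ⊗ₜ[ℤ] z = w at hz
    induction hz using Submodule.mul_induction_on' with
    | mem_mul_mem u hu v hv =>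
      rw [hDmul, (RingHom.mem_ker).1 hu, (RingHom.mem_ker).1 hv, zero_mul, zero_mul, add_zero]
    | add u _ v _ hu hv => rw [map_add, hu, hv, add_zero]
  rw [hD, one_mul, hδ, hr, Ideal.Quotient.eq_zero_iff_mem.2 (show z ∈ m from hz0), map_zero,
    sub_zero] at hDz
  exact hl (hι (by rw [hDz, map_zero]))

end

/-! ### Relations, places and primes -/

section

open Polynomial

/-- A relation over `ℚ[T]` satisfied by `y` can be divided by the content of its coefficients and
cleared of denominators: `y` satisfies a relation with coefficients in `ℤ[T]`, the ideal of which
contains a nonzero integer. Such a relation stays nontrivial after every specialization of `T`,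
in characteristic zero and modulo every prime not dividing that integer. -/
theorem exists_relation_natCast_mem_contentIdeal {A : Type*} [CommRing A] [IsDomain A]
    [Algebra ℚ A] {t : A} (ht : Transcendental ℚ t) {y : A} {P : ℚ[X][X]} (hP : P ≠ 0)
    (hPy : P.eval₂ (aeval (R := ℚ) t).toRingHom y = 0) :
    ∃ (c : ℤ[X][X]) (N : ℕ), N ≠ 0 ∧ c.eval₂ (aeval (R := ℤ) t).toRingHom y = 0 ∧
      (N : ℤ[X]) ∈ c.contentIdeal := by
  classical
  let _ : NormalizedGCDMonoid ℚ[X] := Nonempty.some inferInstance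
  let _ : Algebra ℤ[X] ℚ[X] := Polynomial.algebra ℤ ℚ
  have hinj : Function.Injective (aeval (R := ℚ) t) := transcendental_iff_injective.1 ht
  have hprim : P.primPart.eval₂ (aeval (R := ℚ) t).toRingHom y = 0 := by
    rw [P.eq_C_content_mul_primPart, eval₂_mul, eval₂_C, mul_eq_zero] at hPy
    refine hPy.resolve_left fun h => ?_
    have : P.content = 0 := hinj (by rw [map_zero]; exact h)
    exact hP (content_eq_zero_iff.1 this)
  have htop : P.primPart.contentIdeal = ⊤ :=
    (isPrimitive_iff_contentIdeal_eq_top _).1 P.isPrimitive_primPart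
  let M : Submonoid ℤ[X] := (nonZeroDivisors ℤ).map C
  have : IsLocalization M ℚ[X] := Polynomial.isLocalization _ _
  have halg : algebraMap ℤ[X] ℚ[X] = mapRingHom (algebraMap ℤ ℚ) := rfl
  obtain ⟨b, hbM, hb⟩ := IsLocalization.integerNormalization_spec M P.primPart
  set c := IsLocalization.integerNormalization M P.primPart with hc
  have hct : (1 : ℚ[X]) ∈ c.contentIdeal.map (algebraMap ℤ[X] ℚ[X]) := by
    have hbu : IsUnit (algebraMap ℤ[X] ℚ[X] b) := IsLocalization.map_units ℚ[X] (⟨b, hbM⟩ : M)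
    rw [← contentIdeal_map_eq_map_contentIdeal, hb, ← Ideal.eq_top_iff_one, eq_top_iff, ← htop,
      contentIdeal_def, Ideal.span_le]
    intro x hx
    obtain ⟨i, -, rfl⟩ := mem_coeffs_iff.1 (Finset.mem_coe.1 hx)
    have h1 := coeff_mem_contentIdeal (b • P.primPart) i
    rw [coeff_smul] at h1
    exact (Ideal.unit_mul_mem_iff_mem _ hbu).1 (by rwa [← Algebra.smul_def])
  rw [← map_one (algebraMap ℤ[X] ℚ[X]), IsLocalization.algebraMap_mem_map_algebraMap_iff M] at hct
  obtain ⟨_, ⟨d, hd, rfl⟩, hdc⟩ := hct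
  refine ⟨c, d.natAbs, by simpa using nonZeroDivisors.ne_zero hd, ?_, ?_⟩
  · have hcomp : (aeval (R := ℤ) t).toRingHom
        = (aeval (R := ℚ) t).toRingHom.comp (algebraMap ℤ[X] ℚ[X]) := by
      ext <;> simp [halg]
    rw [hcomp, ← eval₂_map, hb, Algebra.smul_def, eval₂_mul, hprim, mul_zero]
  · rw [mul_one] at hdc
    obtain h | h := Int.natAbs_eq d
    · rw [h] at hdc; simpa using hdc
    · rw [h] at hdc; simpa using hdc

/-- A prime `p` dividing `g(n)`, for an irreducible integer polynomial `g` with root `a`, gives a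
`p`-adic place at which `a` reduces to `n`. -/
theorem exists_valuationSubring_of_dvd_eval {Ω : Type*} [Field Ω] [CharZero Ω] {g : ℤ[X]}
    (hg : Irreducible g) (hdeg : g.natDegree ≠ 0) {a : Ω} (ha : aeval a g = 0) {p : ℕ}
    (hp : p.Prime) {n : ℤ} (hpn : (p : ℤ) ∣ g.eval n) :
    ∃ V : ValuationSubring Ω, (p : Ω) ∈ V.nonunits ∧ a - n ∈ V.nonunits := by
  have hprim : g.IsPrimitive := hg.isPrimitive hdeg
  have hirr : Irreducible (g.map (Int.castRingHom ℚ)) :=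
    (IsPrimitive.Int.irreducible_iff_irreducible_map_cast hprim).1 hg
  let R : Subring Ω := (aeval (R := ℤ) a).toRingHom.range
  let X' : R := (aeval (R := ℤ) a).toRingHom.rangeRestrict X
  have hX' : (X' : Ω) = a := aeval_X a
  have hI : Ideal.span {(p : R), X' - n} ≠ ⊤ := by
    rw [Ne, Ideal.eq_top_iff_one, Ideal.mem_span_pair]
    rintro ⟨⟨_, u, rfl⟩, ⟨_, w, rfl⟩, h⟩
    have h1 : aeval a (1 - (u * C (p : ℤ) + w * (X - C n))) = 0 := by
      have := congrArg (Subtype.val) h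
      simp only [map_sub, map_add, map_mul, map_one, aeval_X, aeval_C]
      rw [sub_eq_zero, eq_comm]
      simpa [hX'] using this
    have h2 : g ∣ 1 - (u * C (p : ℤ) + w * (X - C n)) := by
      rw [IsPrimitive.Int.dvd_iff_map_cast_dvd_map_cast _ _ hprim]
      have h3 : ∀ q : ℤ[X], aeval a (q.map (Int.castRingHom ℚ)) = aeval a q := fun q =>
        aeval_map_algebraMap (A := ℚ) a q
      have hmin := minpoly.eq_of_irreducible hirr (x := a) (by rw [h3, ha])
      refine (Dvd.intro _ hmin).trans (minpoly.dvd ℚ a (by rw [h3, h1]))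
    have h4 : (p : ℤ) ∣ (1 - (u * C (p : ℤ) + w * (X - C n)) : ℤ[X]).eval n :=
      hpn.trans (eval_dvd h2)
    simp only [eval_sub, eval_add, eval_mul, eval_one, eval_X, eval_C, sub_self,
      mul_zero, add_zero] at h4
    have h5 : (p : ℤ) ∣ 1 := (dvd_sub_left (dvd_mul_left _ _)).1 h4
    rw [← Nat.cast_one, Int.natCast_dvd_natCast, Nat.dvd_one] at h5
    exact hp.one_lt.ne' h5
  obtain ⟨V, -, hV⟩ := Ideal.image_subset_nonunits_valuationSubring _ hI
  refine ⟨V, ?_, ?_⟩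
  · exact hV ⟨p, Ideal.subset_span (by simp), by simp⟩
  · exact hV ⟨X' - n, Ideal.subset_span (by simp), by simp [hX']⟩

/-- By Krull's principal ideal theorem, a prime `q` of height at least two containing `x` and `y`
contains a prime `r ∋ x` with `y ∉ r`, if no prime strictly smaller than `q` contains both. -/
theorem exists_prime_le_mem_notMem {R : Type*} [CommRing R] [IsDomain R] [IsNoetherianRing R]
    {q m : Ideal R} [q.IsPrime] [m.IsPrime] (hm : m ≠ ⊥) (hmq : m < q) {x y : R} (hx : x ∈ q)
    (hxy : ∀ r : Ideal R, r.IsPrime → r ≤ q → x ∈ r → y ∈ r → r = q) :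
    ∃ r : Ideal R, r.IsPrime ∧ r ≤ q ∧ x ∈ r ∧ y ∉ r := by
  obtain ⟨r, hr, hrq⟩ := Ideal.exists_minimalPrimes_le (I := Ideal.span {x}) (J := q)
    ((Ideal.span_singleton_le_iff_mem _).2 hx)
  have hrp : r.IsPrime := hr.1.1
  have hxr : x ∈ r := hr.1.2 (Ideal.mem_span_singleton_self x)
  refine ⟨r, hrp, hrq, hxr, fun hyr => ?_⟩
  obtain rfl := hxy r hrp hrq hxr hyr
  have h1 := Ideal.height_le_one_of_isPrincipal_of_mem_minimalPrimes _ r hr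
  have h2 : m.height < r.height := Ideal.height_strict_mono_of_isPrime hmq
  have h3 : (⊥ : Ideal R).height < m.height :=
    Ideal.height_strict_mono_of_isPrime (bot_lt_iff_ne_bot.2 hm)
  have h4 : m.height < 1 := h2.trans_le h1
  rw [Order.lt_one_iff] at h4
  simp [h4] at h3

end

/-! ### Ramification from valuations -/

section

open IsDedekindDomain NumberField

/-- A valuation ring is integrally closed, hence contains all algebraic integers of its field. -/
theorem _root_.ValuationSubring.mem_of_isIntegral_int {K : Type*} [Field K]
    (V : ValuationSubring K) {x : K} (hx : IsIntegral ℤ x) : x ∈ V := by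
  obtain ⟨y, hy⟩ := IsIntegrallyClosed.isIntegral_iff.1 (hx.tower_top (A := V))
  rw [← hy]
  exact y.2

/-- A valuation subring of a number field whose maximal ideal contains the prime number `p` is
dominated by the `𝔭`-adic valuation of a prime `𝔭` over `p`. -/
theorem exists_heightOneSpectrum_of_valuationSubring {k : Type*} [Field k] [NumberField k]
    (B : ValuationSubring k) {p : ℕ} (hp : p ≠ 0) (hpB : (p : k) ∈ B.nonunits) :
    ∃ v : HeightOneSpectrum (𝓞 k), ∀ x ∈ B.nonunits, v.valuation k x < 1 := by
  let i : 𝓞 k →+* B := (algebraMap (𝓞 k) k).codRestrict B.toSubring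
    fun x => B.mem_of_isIntegral_int x.2
  have hi : ∀ x, (i x : k) = x := fun _ => rfl
  let P : Ideal (𝓞 k) := (IsLocalRing.maximalIdeal B).comap i
  have hP : ∀ x, x ∈ P ↔ (x : k) ∈ B.nonunits := fun x => by
    rw [Ideal.mem_comap, ← ValuationSubring.coe_mem_nonunits_iff, hi]
  have hPprime : P.IsPrime := inferInstance
  have hPbot : P ≠ ⊥ := by
    intro h
    have : (p : 𝓞 k) ∈ P := by rw [hP]; simpa using hpB
    rw [h, Ideal.mem_bot] at this
    exact hp (by exact_mod_cast this)
  let v : HeightOneSpectrum (𝓞 k) := ⟨P, hPprime, hPbot⟩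
  -- a `v`-adic unit cannot lie in the maximal ideal of `B`
  have hunit : ∀ x : k, v.valuation k x ≤ 1 → x ∈ B := by
    intro x hx
    obtain ⟨r, ⟨s, hs⟩, hrs⟩ := v.exists_primeCompl_mul_eq_of_integer x hx
    have hs1 : ¬ B.valuation (s : k) < 1 := fun h =>
      hs ((hP s).2 (B.mem_nonunits_iff.2 h))
    have hr1 : B.valuation (r : k) ≤ 1 := (B.valuation_le_one_iff _).2 (i r).2
    rw [← B.valuation_le_one_iff]
    by_contra! hx1
    have h1 := congrArg B.valuation hrs
    rw [map_mul] at h1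
    have h2 : 1 < B.valuation x * B.valuation (s : k) :=
      one_lt_mul_of_lt_of_le hx1 (not_lt.1 hs1)
    exact absurd (h1 ▸ h2) (not_lt.2 hr1)
  refine ⟨v, fun x hx => ?_⟩
  by_contra! h
  have hx0 : x ≠ 0 := by
    rintro rfl
    simp at h
  have h1 : x⁻¹ ∈ B := hunit _ (by rw [map_inv₀]; exact inv_le_one_of_one_le₀ h)
  rw [B.mem_nonunits_iff] at hx
  rw [← B.valuation_le_one_iff, map_inv₀] at h1
  have h0 : 0 < B.valuation x := zero_lt_iff.2 ((map_ne_zero _).2 hx0)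
  exact absurd ((inv_le_one₀ h0).1 h1) (not_le.2 hx)

/-- If `ψ` maps an integral relation `e = ψ z` with `z ∈ q ^ 2` into a field `k` and `p` divides the
integer `e` exactly once, then the prime number `p ∈ q` ramifies in `k`. -/
theorem ramifies_of_map_mem_sq {R k : Type*} [CommRing R] [Field k] [NumberField k]
    (ψ : R →+* k) {q : Ideal R} (hq : q ≠ ⊤) (hker : RingHom.ker ψ ≤ q) {p : ℕ} (hp : p.Prime)
    (hpq : (p : R) ∈ q) {z : R} (hz : z ∈ q ^ 2) {e : ℤ} (he : ψ z = e) (hpe : (p : ℤ) ∣ e)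
    (hpe2 : ¬ (p : ℤ) ^ 2 ∣ e) : Ramifies p k := by
  have hI : q.map ψ.rangeRestrict ≠ ⊤ := by
    intro h
    apply hq
    rw [← Ideal.comap_map_of_surjective' _ ψ.rangeRestrict_surjective q |>.trans
      (sup_eq_left.2 (by rwa [RingHom.ker_rangeRestrict])), h, Ideal.comap_top]
  obtain ⟨B, -, hB⟩ := Ideal.image_subset_nonunits_valuationSubring _ hI
  have hqB : ∀ x ∈ q, ψ x ∈ B.nonunits := fun x hx =>
    hB ⟨_, Ideal.mem_map_of_mem _ hx, rfl⟩
  obtain ⟨v, hv⟩ := exists_heightOneSpectrum_of_valuationSubring B hp.ne_zero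
    (by simpa using hqB _ hpq)
  have hlt : ∀ x ∈ q, v.valuation k (ψ x) ≤ WithZero.exp (-1 : ℤ) := fun x hx => by
    rw [← WithZero.lt_mul_exp_iff_le WithZero.exp_ne_zero, ← WithZero.exp_add, neg_add_cancel,
      WithZero.exp_zero]
    exact hv _ (hqB x hx)
  have hz2 : v.valuation k (ψ z) ≤ WithZero.exp (-2 : ℤ) := by
    clear he
    rw [pow_two] at hz
    induction hz using Submodule.mul_induction_on' with
    | mem_mul_mem x hx y hy =>
      rw [map_mul, map_mul, show (-2 : ℤ) = -1 + -1 by norm_num, WithZero.exp_add]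
      exact mul_le_mul' (hlt x hx) (hlt y hy)
    | add x _ y _ hx hy =>
      rw [map_add]
      exact (v.valuation k).map_add_le hx hy
  have he2 : (e : 𝓞 k) ∈ v.asIdeal ^ 2 := by
    rw [← v.intValuation_le_pow_iff_mem, ← v.valuation_of_algebraMap (K := k)]
    have h1 : algebraMap (𝓞 k) k e = ψ z := by rw [he, map_intCast]
    exact (congrArg (v.valuation k) h1).trans_le hz2
  have hp1 : (p : 𝓞 k) ∈ v.asIdeal := by
    rw [← v.valuation_lt_one_iff_mem (K := k)]
    simpa using hv _ (by simpa using hqB _ hpq)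
  refine ⟨v.asIdeal, v.isPrime, ?_⟩
  -- `p` is the greatest common divisor of `e` and `p ^ 2`
  obtain ⟨c, rfl⟩ := hpe
  have hpc : IsCoprime c (p : ℤ) := by
    rw [isCoprime_comm, Prime.coprime_iff_not_dvd (Nat.prime_iff_prime_int.1 hp)]
    exact fun h => hpe2 (by rw [pow_two]; exact mul_dvd_mul_left _ h)
  obtain ⟨u, w, huw⟩ := hpc
  have huw' : (u : 𝓞 k) * c + w * p = 1 := by exact_mod_cast congrArg (Int.cast (R := 𝓞 k)) huw
  have : (p : 𝓞 k) = u * ((p * c : ℤ) : 𝓞 k) + w * (p : 𝓞 k) ^ 2 := by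
    push_cast
    linear_combination -(p : 𝓞 k) * huw'
  rw [this]
  exact Ideal.add_mem _ (Ideal.mul_mem_left _ _ he2)
    (Ideal.mul_mem_left _ _ (Ideal.pow_mem_pow hp1 2))

/-- Ramification of a prime number persists in algebraic extensions. -/
theorem Ramifies.of_algebra {p : ℕ} {k K : Type*} [Field k] [Field K] [Algebra k K]
    (h : Ramifies p k) : Ramifies p K := by
  obtain ⟨P, hP, hp⟩ := h
  have : Algebra.IsIntegral (𝓞 k) (𝓞 K) := inferInstance
  have : FaithfulSMul (𝓞 k) (𝓞 K) := inferInstance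
  obtain ⟨Q, hQ, hQP⟩ := Ideal.exists_ideal_over_prime_of_isIntegral_of_isDomain (S := 𝓞 K) P
    (((RingHom.injective_iff_ker_eq_bot (algebraMap (𝓞 k) (𝓞 K))).1
      (FaithfulSMul.algebraMap_injective _ _)).trans_le bot_le)
  refine ⟨Q, hQ, ?_⟩
  have h1 := Ideal.mem_map_of_mem (algebraMap (𝓞 k) (𝓞 K)) hp
  rw [Ideal.map_pow, map_natCast] at h1
  exact Ideal.pow_right_mono (Ideal.map_le_iff_le_comap.2 hQP.ge) 2 h1

end

/-! ### Specializing relations -/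

section

open Polynomial NumberField

/-- Specializing the variable of a relation whose coefficients generate an ideal containing `N ≠ 0`
gives a nontrivial relation. -/
theorem exists_map_ne_zero_of_relation {D : Type*} [CommRing D] {n : ℤ} {y : D} {c : ℤ[X][X]}
    (hc : c.eval₂ (aeval (R := ℤ) (n : D)).toRingHom y = 0) {N : ℕ}
    (hN : (N : ℤ[X]) ∈ c.contentIdeal) (hN0 : (N : D) ≠ 0) :
    ∃ f : ℤ[X], f.map (Int.castRingHom D) ≠ 0 ∧ f.eval₂ (Int.castRingHom D) y = 0 := by
  have hcomp : (aeval (R := ℤ) (n : D)).toRingHom = (Int.castRingHom D).comp (evalRingHom n) := by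
    ext <;> simp
  refine ⟨c.map (evalRingHom n), fun h => hN0 ?_, ?_⟩
  · rw [Polynomial.map_map, ← hcomp] at h
    have h1 : c.contentIdeal ≤ RingHom.ker (aeval (R := ℤ) (n : D)).toRingHom := by
      rw [contentIdeal_def, Ideal.span_le]
      intro x hx
      obtain ⟨i, -, rfl⟩ := mem_coeffs_iff.1 (Finset.mem_coe.1 hx)
      have := congrArg (coeff · i) h
      simpa using this
    simpa using h1 hN
  · rw [eval₂_map, ← hcomp, hc]

/-- A domain of characteristic `p` generated over `ℤ` by elements algebraic over the prime field
is a field. -/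
theorem isField_of_relations {D : Type*} [CommRing D] [IsDomain D] {p : ℕ} (hp : p.Prime)
    (hpD : (p : D) = 0) {S : Set D} (hS : Algebra.adjoin ℤ S = ⊤)
    (h : ∀ y ∈ S, ∃ f : ℤ[X], f.map (Int.castRingHom D) ≠ 0 ∧ f.eval₂ (Int.castRingHom D) y = 0) :
    IsField D := by
  have : Fact p.Prime := ⟨hp⟩
  have : CharP D p := ringChar.of_eq (CharP.ringChar_of_prime_eq_zero hp hpD)
  let _ : Algebra (ZMod p) D := ZMod.algebra D p
  have hcast : (algebraMap (ZMod p) D).comp (Int.castRingHom (ZMod p)) = Int.castRingHom D :=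
    RingHom.ext_int _ _
  have hint : (integralClosure (ZMod p) D) = ⊤ := by
    rw [eq_top_iff]
    intro x _
    have hx : x ∈ Algebra.adjoin ℤ S := hS ▸ trivial
    induction hx using Algebra.adjoin_induction with
    | mem y hy =>
      obtain ⟨f, hf, hfy⟩ := h y hy
      refine IsAlgebraic.isIntegral ⟨f.map (Int.castRingHom (ZMod p)), fun h0 => hf ?_, ?_⟩
      · rw [← hcast, ← Polynomial.map_map, h0, Polynomial.map_zero]
      · rw [aeval_def, eval₂_map, hcast, hfy]
    | algebraMap r =>
      have := Subalgebra.algebraMap_mem (integralClosure (ZMod p) D) (r : ZMod p)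
      rwa [map_intCast] at this
    | add x y _ _ hx hy => exact add_mem (hx trivial) (hy trivial)
    | mul x y _ _ hx hy => exact mul_mem (hx trivial) (hy trivial)
  have : Algebra.IsIntegral (ZMod p) D := ⟨fun x => by
    have : x ∈ integralClosure (ZMod p) D := hint ▸ trivial
    exact this⟩
  exact isField_of_isIntegral_of_isField' (R := ZMod p) (Field.toIsField _)

/-- A domain of characteristic zero generated over `ℤ` by algebraic elements embeds into every
algebraically closed field of characteristic zero. -/
theorem exists_injective_ringHom_of_relations {D : Type*} [CommRing D] [IsDomain D] [CharZero D]
    {S : Set D} (hS : Algebra.adjoin ℤ S = ⊤)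
    (h : ∀ y ∈ S, ∃ f : ℤ[X], f.map (Int.castRingHom D) ≠ 0 ∧ f.eval₂ (Int.castRingHom D) y = 0)
    (Ω : Type*) [Field Ω] [IsAlgClosed Ω] [CharZero Ω] :
    ∃ φ : D →+* Ω, Function.Injective φ := by
  have : Algebra.IsAlgebraic ℤ D := by
    refine ⟨fun x => ?_⟩
    have hx : x ∈ Algebra.adjoin ℤ S := hS ▸ trivial
    induction hx using Algebra.adjoin_induction with
    | mem y hy =>
      obtain ⟨f, hf, hfy⟩ := h y hy
      refine ⟨f, fun h0 => hf (by rw [h0, Polynomial.map_zero]), ?_⟩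
      rw [aeval_def]
      exact hfy
    | algebraMap r => exact isAlgebraic_algebraMap r
    | add x y _ _ hx hy => exact hx.add hy
    | mul x y _ _ hx hy => exact hx.mul hy
  have φ : D →ₐ[ℤ] Ω := IsAlgClosed.lift
  refine ⟨φ, (injective_iff_map_eq_zero _).2 fun x hx => ?_⟩
  by_contra hx0
  obtain ⟨d, hd, e, he⟩ := (Algebra.IsAlgebraic.isAlgebraic (R := ℤ) x).exists_nonzero_dvd
    (mem_nonZeroDivisors_of_ne_zero hx0)
  have := congrArg φ he
  rw [map_mul, show φ x = 0 from hx, zero_mul, AlgHom.commutes] at this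
  exact hd (by simpa using this)

/-- Membership in the square of an ideal descends to every subring containing a suitable finite
set. -/
theorem exists_finset_mem_comap_sq {A : Type*} [CommRing A] {I : Ideal A} {z : A}
    (hz : z ∈ I ^ 2) : ∃ T : Finset A, ∀ A₀ : Subalgebra ℤ A, (T : Set A) ⊆ A₀ →
      ∃ z₀ ∈ I.comap A₀.val ^ 2, (z₀ : A) = z := by
  classical
  rw [pow_two] at hz
  induction hz using Submodule.mul_induction_on' with
  | mem_mul_mem x hx y hy =>
    refine ⟨{x, y}, fun A₀ h => ?_⟩
    have hx0 : x ∈ A₀ := h (by simp)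
    have hy0 : y ∈ A₀ := h (by simp)
    refine ⟨⟨x, hx0⟩ * ⟨y, hy0⟩, ?_, rfl⟩
    rw [pow_two]
    exact Ideal.mul_mem_mul hx hy
  | add x _ y _ hx hy =>
    obtain ⟨T, hT⟩ := hx
    obtain ⟨T', hT'⟩ := hy
    refine ⟨T ∪ T', fun A₀ h => ?_⟩
    rw [Finset.coe_union, Set.union_subset_iff] at h
    obtain ⟨x₀, hx₀, rfl⟩ := hT A₀ h.1
    obtain ⟨y₀, hy₀, rfl⟩ := hT' A₀ h.2
    exact ⟨x₀ + y₀, Ideal.add_mem _ hx₀ hy₀, rfl⟩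

theorem exists_int_mul_mem_adjoin {A : Type*} [CommRing A] [Algebra ℚ A] {S : Set A}
    {x : A} (hx : x ∈ Algebra.adjoin ℚ S) :
    ∃ d : ℤ, d ≠ 0 ∧ (d : A) * x ∈ Algebra.adjoin ℤ S := by
  induction hx using Algebra.adjoin_induction with
  | mem y hy => exact ⟨1, one_ne_zero, by simpa using Algebra.subset_adjoin hy⟩
  | algebraMap r =>
    refine ⟨r.den, by exact_mod_cast r.den_nz, ?_⟩
    have : ((r.den : ℤ) : A) * algebraMap ℚ A r = (r.num : A) := by
      rw [← map_intCast (algebraMap ℚ A), ← map_mul, ← map_intCast (algebraMap ℚ A)]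
      congr 1
      exact_mod_cast r.den_mul_eq_num
    rw [this]
    exact intCast_mem _ _
  | add x y _ _ hx hy =>
    obtain ⟨d, hd, hx⟩ := hx
    obtain ⟨e, he, hy⟩ := hy
    refine ⟨d * e, mul_ne_zero hd he, ?_⟩
    have := add_mem (mul_mem (intCast_mem (Algebra.adjoin ℤ S) e) hx)
      (mul_mem (intCast_mem (Algebra.adjoin ℤ S) d) hy)
    convert this using 1
    push_cast
    ring
  | mul x y _ _ hx hy =>
    obtain ⟨d, hd, hx⟩ := hx
    obtain ⟨e, he, hy⟩ := hy
    refine ⟨d * e, mul_ne_zero hd he, ?_⟩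
    convert mul_mem hx hy using 1
    push_cast
    ring

end

/-! ### Lifting the reduction of a critical point -/

section

open Polynomial NumberField

/-- Lifting a point of the special fibre to characteristic zero. Let `R = ℤ[S]` be a domain whose
generators satisfy relations over `ℤ[t]` that stay nontrivial modulo `p`, and let `q` be a prime
of `R` containing `p`, `t - n` and a nonzero prime not containing `p`. Then there is a
homomorphism from `R` to a field of characteristic zero that maps `t` to `n` and whose kernel is
contained in `q`. -/
theorem exists_ringHom_ker_le {R : Type*} [CommRing R] [IsDomain R] {S : Set R} (hSf : S.Finite)
    (hS : Algebra.adjoin ℤ S = ⊤) {t : R} {n : ℤ} {p : ℕ} (hp : p.Prime)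
    (hrel : ∀ y ∈ S, ∃ (c : ℤ[X][X]) (N : ℕ), c.eval₂ (aeval (R := ℤ) t).toRingHom y = 0 ∧
      (N : ℤ[X]) ∈ c.contentIdeal ∧ ¬ p ∣ N)
    {m q : Ideal R} [m.IsPrime] [hq : q.IsPrime] (hm : m ≠ ⊥) (hmq : m ≤ q) (hpm : (p : R) ∉ m)
    (hpq : (p : R) ∈ q) (htq : t - n ∈ q) (Ω : Type*) [Field Ω] [IsAlgClosed Ω] [CharZero Ω] :
    ∃ ψ : R →+* Ω, ψ t = n ∧ RingHom.ker ψ ≤ q := by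
  have : Algebra.FiniteType ℤ R := ⟨⟨hSf.toFinset, by simpa using hS⟩⟩
  have : IsNoetherianRing R := Algebra.FiniteType.isNoetherianRing ℤ R
  have hcop : ∀ (I : Ideal R), I ≠ ⊤ → (p : R) ∈ I → ∀ N : ℕ, (N : R) ∈ I → p ∣ N := by
    intro I hI hpI N hNI
    by_contra h
    obtain ⟨u, w, huw⟩ := Nat.isCoprime_iff_coprime.2 ((hp.coprime_iff_not_dvd).2 h)
    apply hI
    rw [Ideal.eq_top_iff_one]
    have h1 : (u : R) * p + w * N = 1 := by exact_mod_cast congrArg (Int.cast (R := R)) huw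
    rw [← h1]
    exact Ideal.add_mem _ (Ideal.mul_mem_left _ _ hpI) (Ideal.mul_mem_left _ _ hNI)
  -- the relations specialize to every quotient by a prime in which `t = n`
  have hspec : ∀ r : Ideal R, r.IsPrime → t - n ∈ r →
      (∀ N : ℕ, ¬ p ∣ N → (N : R ⧸ r) ≠ 0) → ∀ y ∈ Ideal.Quotient.mk r '' S,
        ∃ f : ℤ[X], f.map (Int.castRingHom (R ⧸ r)) ≠ 0 ∧
          f.eval₂ (Int.castRingHom (R ⧸ r)) y = 0 := by
    rintro r hr htr hN _ ⟨y, hy, rfl⟩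
    obtain ⟨c, N, hc, hNc, hpN⟩ := hrel y hy
    refine exists_map_ne_zero_of_relation (n := n) (c := c) ?_ hNc (hN N hpN)
    have h1 := congrArg (Ideal.Quotient.mk r) hc
    rw [hom_eval₂, map_zero] at h1
    have h2 : (Ideal.Quotient.mk r) t = n := by
      rw [← sub_eq_zero, ← map_intCast (Ideal.Quotient.mk r), ← map_sub]
      exact Ideal.Quotient.eq_zero_iff_mem.2 htr
    rw [← h1]
    congr 1
    ext <;> simp [h2]
  have hgen : ∀ r : Ideal R, Algebra.adjoin ℤ (Ideal.Quotient.mk r '' S) = ⊤ := by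
    intro r
    have h := AlgHom.map_adjoin (Ideal.Quotient.mkₐ ℤ r) S
    rw [hS, Algebra.map_top, AlgHom.range_eq_top _ |>.2 (Ideal.Quotient.mkₐ_surjective ℤ r)] at h
    exact h.symm
  -- `r` is a curve through `q` on the arithmetic surface along which `t = n`; it is not vertical,
  -- since a prime containing both `p` and `t - n` has a finite residue ring
  obtain ⟨r, hr, hrq, htr, hpr⟩ := exists_prime_le_mem_notMem hm
    (lt_of_le_of_ne hmq fun h => hpm (h ▸ hpq)) htq (y := (p : R)) (by
      intro r hr hrq htr hpr
      have hp0 : (p : R ⧸ r) = 0 := by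
        rw [← map_natCast (Ideal.Quotient.mk r), Ideal.Quotient.eq_zero_iff_mem]
        exact hpr
      have := isField_of_relations hp hp0 (hgen r) (hspec r hr htr fun N hN h0 => hN (by
        rw [← map_natCast (Ideal.Quotient.mk r), Ideal.Quotient.eq_zero_iff_mem] at h0
        exact hcop r hr.ne_top hpr N h0))
      exact (Ideal.Quotient.maximal_of_isField r this).eq_of_le hq.ne_top hrq)
  have : CharZero (R ⧸ r) := by
    obtain h | ⟨l, hl, hlr⟩ := CharP.exists' (R ⧸ r)
    · exact h
    · have h1 : (l : R) ∈ r := by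
        rw [← Ideal.Quotient.eq_zero_iff_mem, map_natCast, CharP.cast_eq_zero]
      have h2 := hcop q hq.ne_top hpq l (hrq h1)
      rw [(Nat.prime_dvd_prime_iff_eq hp hl.out).1 h2] at hpr
      exact absurd h1 hpr
  obtain ⟨φ, hφ⟩ := exists_injective_ringHom_of_relations (hgen r)
    (hspec r hr htr fun N hN => Nat.cast_ne_zero.2 fun h => hN (h ▸ dvd_zero p)) Ω
  refine ⟨φ.comp (Ideal.Quotient.mk r), ?_, ?_⟩
  · have h2 : (Ideal.Quotient.mk r) t = n := by
      rw [← sub_eq_zero, ← map_intCast (Ideal.Quotient.mk r), ← map_sub]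
      exact Ideal.Quotient.eq_zero_iff_mem.2 htr
    rw [RingHom.comp_apply, h2, map_intCast]
  · rw [← RingHom.comap_ker, (RingHom.injective_iff_ker_eq_bot φ).1 hφ, ← RingHom.ker_eq_comap_bot,
      Ideal.mk_ker]
    exact hrq

/-- Let `A` be the coordinate ring of an affine curve over `ℚ`, let `t` be a function on it and
let `ev` be a geometric point at which `g(t)` vanishes to order at least two, where `g` is an
irreducible integer polynomial whose roots include the value of `t`. For large primes `p` with `p
∥ g(n)` there is another geometric point `φ` with `t(φ) = n` whose field of definition is ramified
at `p`.

The curve is spread out to `A₀ = ℤ[S]`, a two-dimensional domain. A place `V` over `p` at which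
`ev t ≡ n` gives a prime `q` of `A₀`, the reduction of `ev`, and `φ` is a lift of this reduction
along `t = n`. As `g(t)` lies in `(ker ev) ^ 2 ⊆ q ^ 2`, the integer `g(n)` lies in the square of
a prime over `p`. -/
theorem exists_ringHom_ramifies {A : Type*} [CommRing A] [IsDomain A] [Algebra ℚ A]
    [Algebra.FiniteType ℚ A] {t : A} (ht : Transcendental ℚ t)
    (halg : ∀ y : A, ∃ P : ℚ[X][X], P ≠ 0 ∧ P.eval₂ (aeval (R := ℚ) t).toRingHom y = 0)
    {Ω : Type*} [Field Ω] [CharZero Ω] [IsAlgClosed Ω] [Algebra.IsAlgebraic ℚ Ω]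
    (ev : A →+* Ω) {g : ℤ[X]} (hg : Irreducible g) (hdeg : g.natDegree ≠ 0)
    (hga : aeval (ev t) g = 0) (hmult : aeval t g ∈ RingHom.ker ev ^ 2) :
    ∃ p₀ : ℕ, ∀ p : ℕ, p.Prime → p₀ ≤ p → ∀ n : ℤ, (p : ℤ) ∣ g.eval n → ¬ (p : ℤ) ^ 2 ∣ g.eval n →
      ∃ φ : A →+* Ω, φ t = n ∧
        ∀ K : IntermediateField ℚ Ω, (∀ x, φ x ∈ K) → Ramifies p K := by
  classical
  obtain ⟨S₀, hS₀⟩ := Algebra.FiniteType.out (R := ℚ) (A := A)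
  obtain ⟨T, hT⟩ := exists_finset_mem_comap_sq hmult
  choose P hP hPy using halg
  choose c N hN hcy hNc using fun y => exists_relation_natCast_mem_contentIdeal ht (hP y) (hPy y)
  let S : Finset A := insert t (S₀ ∪ T)
  have hSQ : Algebra.adjoin ℚ (S : Set A) = ⊤ :=
    top_le_iff.1 (hS₀ ▸ Algebra.adjoin_mono (by simp only [S]; push_cast; grind))
  set A₀ := Algebra.adjoin ℤ (S : Set A) with hA₀
  have hSA₀ : (S : Set A) ⊆ A₀ := Algebra.subset_adjoin
  obtain ⟨z, hz, hzg⟩ := hT A₀ (Set.Subset.trans (by simp only [S]; push_cast; grind) hSA₀)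
  let t₀ : A₀ := ⟨t, hSA₀ (by simp [S])⟩
  have hzt : z = aeval t₀ g := by
    apply Subtype.ext
    rw [hzg]
    exact (aeval_algHom_apply A₀.val t₀ g)
  have : Algebra.IsAlgebraic ℤ ℚ := IsLocalization.isAlgebraic ℚ (nonZeroDivisors ℤ)
  have : Algebra.IsAlgebraic ℤ Ω := Algebra.IsAlgebraic.trans ℤ ℚ Ω
  obtain ⟨M, hM0, hM⟩ := Algebra.IsAlgebraic.exists_integral_multiples ℤ (S.image ev)
  -- `p > |M|` makes `ev` integral at the places over `p`; `p > N y` keeps the relation of `y`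
  -- nontrivial modulo `p`
  refine ⟨max (M.natAbs + 1) (S.sup N + 1), fun p hp hpp n hpn hpn2 => ?_⟩
  have hpM : ¬ (p : ℤ) ∣ M := fun h => by
    have := Nat.le_of_dvd (Int.natAbs_pos.2 hM0) (Int.natCast_dvd.1 h)
    omega
  have hpN : ∀ y ∈ S, ¬ p ∣ N y := fun y hy h => by
    have h1 := Nat.le_of_dvd (Nat.pos_of_ne_zero (hN y)) h
    have h2 := Finset.le_sup (f := N) hy
    omega
  obtain ⟨V, hpV, hnV⟩ := exists_valuationSubring_of_dvd_eval hg hdeg hga hp hpn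
  -- `M` is a unit at the place `V`, so `V` contains the image of `A₀`
  have hMV : V.valuation (M : Ω) = 1 := by
    refine le_antisymm ((V.valuation_le_one_iff _).2 (intCast_mem V M)) (not_lt.1 fun h => ?_)
    obtain ⟨u, w, huw⟩ := ((Nat.prime_iff_prime_int.1 hp).coprime_iff_not_dvd).2 hpM
    have h1 : (u : Ω) * p + w * M = 1 := by
      exact_mod_cast congrArg (Int.cast (R := Ω)) huw
    have h2 : V.valuation ((u : Ω) * p + w * M) < 1 := by
      refine Valuation.map_add_lt _ ?_ ?_
      · rw [map_mul]
        exact (mul_le_of_le_one_left' ((V.valuation_le_one_iff _).2 (intCast_mem V u))).trans_lt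
          (V.mem_nonunits_iff.1 hpV)
      · rw [map_mul]
        exact (mul_le_of_le_one_left' ((V.valuation_le_one_iff _).2 (intCast_mem V w))).trans_lt h
    rw [h1, map_one] at h2
    exact lt_irrefl _ h2
  have hSV : ∀ y ∈ S, ev y ∈ V := by
    intro y hy
    have h1 := V.mem_of_isIntegral_int (hM (ev y) (Finset.mem_image_of_mem ev hy))
    rw [← V.valuation_le_one_iff, zsmul_eq_mul, map_mul, hMV, one_mul] at h1
    exact (V.valuation_le_one_iff _).1 h1
  have hA₀V : ∀ x : A₀, ev x ∈ V := by
    rintro ⟨x, hx⟩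
    induction hx using Algebra.adjoin_induction with
    | mem y hy => exact hSV y hy
    | algebraMap r => simp
    | add x y _ _ hx hy => rw [map_add]; exact add_mem hx hy
    | mul x y _ _ hx hy => rw [map_mul]; exact mul_mem hx hy
  let e : A₀ →+* Ω := ev.comp A₀.val.toRingHom
  let e' : A₀ →+* V := e.codRestrict V.toSubring hA₀V
  -- the reduction of `ev` at the place `V`
  let q : Ideal A₀ := (IsLocalRing.maximalIdeal V).comap e'
  have hq : ∀ x, x ∈ q ↔ ev x ∈ V.nonunits := fun x => by
    rw [Ideal.mem_comap, ← ValuationSubring.coe_mem_nonunits_iff]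
    rfl
  have hqp : q.IsPrime := inferInstance
  have hmq : RingHom.ker e ≤ q := fun x hx => by
    rw [hq, show ev x = 0 from hx]
    exact zero_mem _
  have hpq : (p : A₀) ∈ q := (hq _).2 (by simpa using! hpV)
  have htq : t₀ - n ∈ q := (hq _).2 (by simpa [t₀] using hnV)
  have hmp : (RingHom.ker e).IsPrime := RingHom.ker_isPrime e
  have hm0 : RingHom.ker e ≠ ⊥ := by
    intro h
    have h1 : z ∈ RingHom.ker e := Ideal.pow_le_self two_ne_zero hz
    rw [h, Ideal.mem_bot] at h1
    have h2 : aeval t g = 0 := by rw [← hzg, h1, ZeroMemClass.coe_zero]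
    have h3 : aeval t (g.map (algebraMap ℤ ℚ)) = 0 := by rw [aeval_map_algebraMap, h2]
    have h4 := (transcendental_iff.1 ht) _ h3
    rw [Polynomial.map_eq_zero_iff (algebraMap ℤ ℚ).injective_int] at h4
    exact hg.ne_zero h4
  have hpm : (p : A₀) ∉ RingHom.ker e := by
    rw [RingHom.mem_ker, map_natCast]
    exact Nat.cast_ne_zero.2 hp.ne_zero
  obtain ⟨ψ, hψt, hψ⟩ := exists_ringHom_ker_le (S := (Subtype.val : A₀ → A) ⁻¹' (S : Set A))
    (S.finite_toSet.preimage Subtype.val_injective.injOn) Algebra.adjoin_adjoin_coe_preimage hp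
    (t := t₀) (n := n) (by
      intro y hy
      refine ⟨c y, N y, Subtype.ext ?_, hNc y, hpN y hy⟩
      have h1 : A₀.val.toRingHom.comp (aeval (R := ℤ) t₀).toRingHom = (aeval t).toRingHom := by
        ext <;> simp [t₀]
      refine (hom_eval₂ (c y) _ A₀.val.toRingHom y).trans ?_
      rw [h1, ZeroMemClass.coe_zero]
      exact hcy y) hm0 hmq hpm hpq htq Ω
  -- `A` is the localization of `A₀` at the nonzero integers
  let W : Submonoid A₀ := Algebra.algebraMapSubmonoid A₀ (nonZeroDivisors ℤ)
  have hWA : ∀ w : W, IsUnit (algebraMap A₀ A w) := by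
    rintro ⟨_, d, hd, rfl⟩
    have h1 : IsUnit (algebraMap ℚ A d) :=
      (IsUnit.mk0 (d : ℚ) (by simpa using nonZeroDivisors.ne_zero hd)).map (algebraMap ℚ A)
    simpa using h1
  have hloc : IsLocalization W A := by
    refine ⟨hWA, fun x => ?_, fun {x y} hxy => ⟨1, by rw [Subtype.ext hxy]⟩⟩
    obtain ⟨d, hd, hdx⟩ := exists_int_mul_mem_adjoin (S := S) (x := x) (hSQ ▸ trivial)
    refine ⟨⟨⟨_, hdx⟩, ⟨algebraMap ℤ A₀ d, d, mem_nonZeroDivisors_of_ne_zero hd, rfl⟩⟩, ?_⟩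
    change x * ((algebraMap ℤ A₀ d : A₀) : A) = (d : A) * x
    simp [mul_comm]
  have hWΩ : ∀ w : W, IsUnit (ψ w) := by
    rintro ⟨_, d, hd, rfl⟩
    simpa using nonZeroDivisors.ne_zero hd
  let φ : A →+* Ω := IsLocalization.lift hWΩ
  have hφ : ∀ x : A₀, φ x = ψ x := fun x => IsLocalization.lift_eq hWΩ x
  refine ⟨φ, (hφ t₀).trans hψt, fun K hK => ?_⟩
  -- `K` may have infinite degree over `ℚ`, so ramification is first found in the number field `k`
  let k : IntermediateField ℚ Ω := IntermediateField.adjoin ℚ (φ '' S)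
  have hkK : k ≤ K := IntermediateField.adjoin_le_iff.2 (by rintro _ ⟨x, -, rfl⟩; exact hK x)
  have : Finite (φ '' S) := (S.finite_toSet.image φ).to_subtype
  have : FiniteDimensional ℚ k := IntermediateField.finiteDimensional_adjoin
    fun x _ => Algebra.IsIntegral.isIntegral x
  have : NumberField k := { to_charZero := inferInstance, to_finiteDimensional := by convert this }
  have hψk : ∀ x : A₀, ψ x ∈ k := by
    rintro ⟨x, hx⟩
    rw [← hφ]
    induction hx using Algebra.adjoin_induction with
    | mem y hy => exact IntermediateField.subset_adjoin _ _ ⟨y, hy, rfl⟩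
    | algebraMap r => simp
    | add x y _ _ hx hy => rw [map_add]; exact add_mem hx hy
    | mul x y _ _ hx hy => rw [map_mul]; exact mul_mem hx hy
  have hram : Ramifies p k := by
    refine ramifies_of_map_mem_sq (ψ.codRestrict k hψk) hqp.ne_top ?_ hp hpq
      (Ideal.pow_right_mono (fun x hx => hmq hx) 2 hz : z ∈ q ^ 2) (e := g.eval n) ?_ hpn hpn2
    · intro x hx
      exact hψ (congrArg Subtype.val (show ψ.codRestrict k hψk x = 0 from hx))
    · apply Subtype.ext
      change ψ z = _
      rw [hzt, aeval_def, hom_eval₂, hψt]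
      have h1 : ψ.comp (algebraMap ℤ A₀) = Int.castRingHom Ω := RingHom.ext_int _ _
      rw [h1, eval₂_at_intCast]
      simp
  let _ : Algebra k K := (IntermediateField.inclusion hkK).toRingHom.toAlgebra
  exact hram.of_algebra

end

/-! ### Local rings and geometric points of the curve -/

section

universe u

open Polynomial in
/-- Any element `y` of the function field of a smooth affine curve is related to a given
transcendental element `t` by a polynomial. -/
theorem exists_relation_of_isStandardSmoothOfRelativeDimension_one {k : Type*} {A L : Type u}
    [Field k] [CharZero k] [CommRing A] [Algebra k A]
    [Algebra.IsStandardSmoothOfRelativeDimension 1 k A]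
    [Field L] [Algebra A L] [IsFractionRing A L] [Algebra k L] [IsScalarTower k A L]
    {t : L} (ht : Transcendental k t) (y : L) :
    ∃ P : k[X][X], P ≠ 0 ∧ P.eval₂ (aeval (R := k) t).toRingHom y = 0 := by
  have : Nontrivial A := (algebraMap A L).domain_nontrivial
  have : Algebra.IsStandardSmooth k A :=
    Algebra.IsStandardSmoothOfRelativeDimension.isStandardSmooth 1
  have : Algebra.EssFiniteType A L := Algebra.EssFiniteType.of_isLocalization L (nonZeroDivisors A)
  have : Algebra.EssFiniteType k L := Algebra.EssFiniteType.comp k A L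
  have hrank : Module.rank L (Ω[L⁄k]) = 1 := by
    have : Algebra.FormallyEtale A L := Algebra.FormallyEtale.of_isLocalization (nonZeroDivisors A)
    rw [← (KaehlerDifferential.tensorKaehlerEquivOfFormallyEtale k A L).rank_eq,
      Module.rank_baseChange,
      Algebra.IsStandardSmoothOfRelativeDimension.rank_kaehlerDifferential 1]
    simp
  have halg := isAlgebraic_adjoin_of_rank_kaehlerDifferential_eq_one hrank ht
  have h1 : IsAlgebraic (Algebra.adjoin k {t}) y := by
    open scoped IntermediateField.algebraAdjoinAdjoin in
    rw [IsFractionRing.isAlgebraic_iff _ (IntermediateField.adjoin k {t})]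
    exact halg.isAlgebraic y
  obtain ⟨f, hf0, hf⟩ := h1
  let π : k[X] →+* Algebra.adjoin k {t} :=
    (aeval (⟨t, Algebra.self_mem_adjoin_singleton k t⟩ : Algebra.adjoin k {t})).toRingHom
  have hπ : Function.Surjective π := by
    rintro ⟨x, hx⟩
    rw [Algebra.adjoin_singleton_eq_range_aeval] at hx
    obtain ⟨q, rfl⟩ := hx
    exact ⟨q, Subtype.ext (aeval_algHom_apply (Algebra.adjoin k {t}).val _ q).symm⟩
  obtain ⟨P, rfl⟩ := Polynomial.map_surjective π hπ f
  refine ⟨P, fun h => hf0 (by rw [h, Polynomial.map_zero]), ?_⟩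
  have hcomp : (algebraMap (Algebra.adjoin k {t}) L).comp π = (aeval t).toRingHom := by
    ext <;> simp [π]
  rw [← hcomp, ← eval₂_map]
  exact hf

/-- A point with algebraic coordinates is closed. -/
theorem isMaximal_ker_of_isAlgebraic {k A Ω : Type*} [Field k] [CommRing A] [Algebra k A] [Field Ω]
    [Algebra k Ω] [Algebra.IsAlgebraic k Ω] (ev : A →ₐ[k] Ω) : (RingHom.ker ev).IsMaximal := by
  have : (RingHom.ker ev).IsPrime := RingHom.ker_isPrime ev
  have : Algebra.IsAlgebraic k (A ⧸ RingHom.ker ev) :=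
    Algebra.IsAlgebraic.of_injective (Ideal.kerLiftAlg ev) (Ideal.kerLiftAlg_injective ev)
  exact Ideal.Quotient.maximal_of_isField _
    (isField_of_isIntegral_of_isField' (R := k) (Field.toIsField k))

/-- The square of a maximal ideal is primary. -/
theorem mem_sq_of_mul_mem_sq {A : Type*} [CommRing A] {m : Ideal A} [hm : m.IsMaximal] {h x : A}
    (hh : h ∉ m) (hx : h * x ∈ m ^ 2) : x ∈ m ^ 2 := by
  have := Ideal.IsMaximal.exists_inv hm hh
  obtain ⟨c, z, hz, hcz⟩ := this
  have h1 : x ∈ m := by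
    have := Ideal.pow_le_self two_ne_zero hx
    exact (hm.isPrime.mem_or_mem this).resolve_left hh
  have : x = c * (h * x) + z * x := by linear_combination -x * hcz
  rw [this]
  exact Ideal.add_mem _ (Ideal.mul_mem_left _ _ hx) (pow_two m ▸ Ideal.mul_mem_mul hz h1)

open Polynomial in
/-- If `s - a` vanishes modulo `I` and `a` is a root of `g`, then `g(s)` vanishes modulo `I`:
factor `X - a` out of `g` over `Ω`. -/
theorem one_tmul_aeval_mem_of_root {O Ω : Type*} [CommRing O] [CommRing Ω] {I : Ideal (Ω ⊗[ℤ] O)}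
    {s : O} {a : Ω} (h : (1 : Ω) ⊗ₜ[ℤ] s - a ⊗ₜ[ℤ] (1 : O) ∈ I) {g : ℤ[X]} (hg : aeval a g = 0) :
    (1 : Ω) ⊗ₜ[ℤ] aeval s g ∈ I := by
  have h1 : (1 : Ω) ⊗ₜ[ℤ] aeval s g = aeval ((1 : Ω) ⊗ₜ[ℤ] s) (g.map (algebraMap ℤ Ω)) := by
    rw [aeval_map_algebraMap]
    exact (aeval_algHom_apply (Algebra.TensorProduct.includeRight : O →ₐ[ℤ] Ω ⊗[ℤ] O) s g).symm
  obtain ⟨q, hq⟩ : X - C a ∣ g.map (algebraMap ℤ Ω) := by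
    rw [dvd_iff_isRoot, IsRoot, eval_map_algebraMap, hg]
  rw [h1, hq, map_mul, map_sub, aeval_X, aeval_C]
  exact Ideal.mul_mem_right _ _ h

variable {X : Scheme.{0}} {π : X ⟶ Spec (.of ℚ)}

/-- The coordinate rings of affine opens of a scheme locally of finite type over `ℚ` are finitely
generated `ℚ`-algebras. -/
theorem exists_ringHom_finiteType [LocallyOfFiniteType π] {U : X.Opens} (hU : IsAffineOpen U) :
    ∃ f : ℚ →+* Γ(X, U), f.FiniteType := by
  have h1 := π.finiteType_appLE (isAffineOpen_top _) hU (by simp)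
  refine ⟨(π.appLE ⊤ U (by simp)).hom.comp (Scheme.ΓSpecIso (.of ℚ)).inv.hom, h1.comp ?_⟩
  exact RingHom.FiniteType.of_surjective _
    (ConcreteCategory.bijective_of_isIso (Scheme.ΓSpecIso (.of ℚ)).inv).surjective

theorem exists_ringHom_isStandardSmooth (hπ : SmoothOfRelativeDimension 1 π) (x : X) :
    ∃ (U : X.Opens) (_ : IsAffineOpen U) (_ : x ∈ U) (f : ℚ →+* Γ(X, U)),
      f.IsStandardSmoothOfRelativeDimension 1 := by
  obtain ⟨W, hW, U, hU, hx, e, hf⟩ := hπ.exists_isStandardSmoothOfRelativeDimension x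
  have hWt : W = ⊤ := by
    ext y
    have : y = π x := Subsingleton.elim (α := PrimeSpectrum ℚ) _ _
    simpa [this] using e hx
  subst hWt
  refine ⟨U, hU, hx, (π.appLE ⊤ U e).hom.comp
    (Scheme.ΓSpecIso (.of ℚ)).commRingCatIsoToRingEquiv.symm.toRingHom, ?_⟩
  exact (RingHom.isStandardSmoothOfRelativeDimension_respectsIso (n := 1)).2 _ _ hf

/-- The geometric point of `X` given by a `Qbar`-valued point of an affine open `U`. It
automatically lies over `ℚ`, since a ring homomorphism out of `ℚ` is unique. -/
noncomputable def geomPointOfRingHom (π : X ⟶ Spec (.of ℚ)) {U : X.Opens} (hU : IsAffineOpen U)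
    (φ : Γ(X, U) →+* Qbar) : GeomPoint π :=
  ⟨Spec.map (CommRingCat.ofHom φ) ≫ hU.fromSpec, by
    obtain ⟨f, hf⟩ := Spec.map_surjective ((Spec.map (CommRingCat.ofHom φ) ≫ hU.fromSpec) ≫ π)
    rw [← hf]
    congr 1
    ext : 1
    exact Subsingleton.elim _ _⟩

variable {U : X.Opens} (hU : IsAffineOpen U) (φ : Γ(X, U) →+* Qbar)

theorem geomPointOfRingHom_pt_mem : (geomPointOfRingHom π hU φ).pt ∈ U := by
  have : (geomPointOfRingHom π hU φ).pt
      = hU.fromSpec (Spec.map (CommRingCat.ofHom φ) (IsLocalRing.closedPoint Qbar)) := rfl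
  rw [this]
  have := hU.range_fromSpec
  rw [← SetLike.mem_coe, ← this]
  exact ⟨_, rfl⟩

theorem germ_stalkClosedPointTo_fromSpec
    (hx : (Spec.map (CommRingCat.ofHom φ) ≫ hU.fromSpec) (IsLocalRing.closedPoint Qbar) ∈ U) :
    X.presheaf.germ U _ hx ≫
        Scheme.stalkClosedPointTo (Spec.map (CommRingCat.ofHom φ) ≫ hU.fromSpec) =
      CommRingCat.ofHom φ := by
  apply Spec.map_injective
  rw [← cancel_mono hU.fromSpec, Spec.map_comp, Category.assoc]
  have := Scheme.Spec_stalkClosedPointTo_fromSpecStalk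
    (Spec.map (CommRingCat.ofHom φ) ≫ hU.fromSpec)
  rw [← hU.fromSpecStalk_eq_fromSpecStalk hx] at this
  exact this

theorem geomPointOfRingHom_eval_germ (x : Γ(X, U)) :
    (geomPointOfRingHom π hU φ).eval
      (X.presheaf.germ U _ (geomPointOfRingHom_pt_mem hU φ) x) = φ x :=
  congrArg (fun f => f.hom x) (germ_stalkClosedPointTo_fromSpec hU φ
    (geomPointOfRingHom_pt_mem (π := π) hU φ))

end

/-! ### Ramification in the field generated by a fiber -/

section

open Polynomial

/-- Vanishing to order two at a point with algebraic coordinates can be tested after localization.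
-/
theorem mem_ker_sq_of_isLocalization {A O Ω : Type*} [CommRing A] [CommRing O] [Algebra A O]
    (M : Submonoid A) [IsLocalization M O] [Algebra ℚ A] [Field Ω] [Algebra ℚ Ω]
    [Algebra.IsAlgebraic ℚ Ω] (ev : O →+* Ω) {z : A} (hz : algebraMap A O z ∈ RingHom.ker ev ^ 2) :
    z ∈ RingHom.ker (ev.comp (algebraMap A O)) ^ 2 := by
  have hmax : (RingHom.ker (ev.comp (algebraMap A O))).IsMaximal :=
    isMaximal_ker_of_isAlgebraic (ev.comp (algebraMap A O)).toRatAlgHom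
  have hmap : RingHom.ker ev = (RingHom.ker (ev.comp (algebraMap A O))).map (algebraMap A O) :=
    (IsLocalization.map_under M O (RingHom.ker ev)).symm
  rw [hmap, ← Ideal.map_pow, IsLocalization.mem_map_algebraMap_iff M] at hz
  obtain ⟨⟨⟨x, hx⟩, s⟩, h⟩ := hz
  rw [← map_mul] at h
  obtain ⟨c, hc⟩ := IsLocalization.exists_of_eq (M := M) h
  refine mem_sq_of_mul_mem_sq (h := (c : A) * s) ?_ ?_
  · rw [RingHom.mem_ker, ← Submonoid.coe_mul]
    exact ((IsLocalization.map_units O (c * s)).map ev).ne_zero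
  · rw [mul_assoc, mul_comm (s : A), hc]
    exact Ideal.mul_mem_left _ _ hx

variable {X : Scheme.{0}} {π : X ⟶ Spec (.of ℚ)}

/-- The function field of a curve over `ℚ` is algebraic over the field generated by `t`. -/
theorem exists_relation_functionField [IsIntegral X] [Algebra ℚ X.functionField]
    (hπ : SmoothOfRelativeDimension 1 π) {t : X.functionField} (ht : Transcendental ℚ t)
    (y : X.functionField) :
    ∃ P : ℚ[X][X], P ≠ 0 ∧ P.eval₂ (aeval (R := ℚ) t).toRingHom y = 0 := by
  obtain ⟨U, hU, hx, f, hf⟩ := exists_ringHom_isStandardSmooth hπ (genericPoint X)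
  have : Nonempty U := ⟨⟨_, hx⟩⟩
  let _ : Algebra ℚ Γ(X, U) := f.toAlgebra
  have : Algebra.IsStandardSmoothOfRelativeDimension 1 ℚ Γ(X, U) := hf
  have : IsFractionRing Γ(X, U) X.functionField :=
    functionField_isFractionRing_of_isAffineOpen X U hU
  have : IsScalarTower ℚ Γ(X, U) X.functionField :=
    IsScalarTower.of_algebraMap_eq' (Subsingleton.elim _ _)
  exact exists_relation_of_isStandardSmoothOfRelativeDimension_one (A := Γ(X, U)) ht y

theorem exists_section_of_stalk {x : X} (s : X.presheaf.stalk x) :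
    ∃ (U : X.Opens) (_ : IsAffineOpen U) (hx : x ∈ U) (σ : Γ(X, U)),
      X.presheaf.germ U x hx σ = s := by
  obtain ⟨V, hV, τ, rfl⟩ := X.presheaf.exists_germ_eq s
  obtain ⟨_, ⟨U, hU, rfl⟩, hx, hUV⟩ := X.isBasis_affineOpens.exists_subset_of_mem_open hV V.2
  refine ⟨U, hU, hx, X.presheaf.map (homOfLE hUV).op τ, ?_⟩
  exact X.presheaf.germ_res_apply (homOfLE hUV) x hx τ

/-- A multiple zero of `σ - a` on the base change of the curve to `Qbar` is a multiple zero of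
`g(σ)` on the curve over `ℚ`, for every integer polynomial `g` that vanishes at `a`. -/
theorem germ_aeval_mem_ker_sq {U : X.Opens} (hU : IsAffineOpen U) (f : ℚ →+* Γ(X, U))
    {P : GeomPoint π} (hP : P.pt ∈ U) {σ : Γ(X, U)} {a : Qbar}
    (h : (1 : Qbar) ⊗ₜ[ℤ] (X.presheaf.germ U P.pt hP σ) - a ⊗ₜ[ℤ] (1 : P.localRing) ∈
      (RingHom.ker P.geomEval) ^ 2) {g : ℤ[X]} (hg : aeval a g = 0) :
    aeval σ g ∈ RingHom.ker (P.eval.comp (X.presheaf.germ U P.pt hP).hom) ^ 2 := by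
  have : Algebra.IsAlgebraic ℚ Qbar := AlgebraicClosure.isAlgebraic ℚ
  let _ : Algebra ℚ Γ(X, U) := f.toAlgebra
  let _ : Algebra ℚ P.localRing := ((X.presheaf.germ U P.pt hP).hom.comp f).toAlgebra
  let _ : Algebra Γ(X, U) P.localRing := (X.presheaf.germ U P.pt hP).hom.toAlgebra
  have : IsLocalization.AtPrime P.localRing (hU.primeIdealOf ⟨P.pt, hP⟩).asIdeal :=
    hU.isLocalization_stalk ⟨P.pt, hP⟩
  refine mem_ker_sq_of_isLocalization (O := P.localRing)
    (hU.primeIdealOf ⟨P.pt, hP⟩).asIdeal.primeCompl P.eval ?_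
  refine mem_ker_sq_of_one_tmul_mem P.eval P.geomEval.toRingHom ?_ ?_
  · intro c x
    exact Algebra.TensorProduct.lift_tmul _ _ _ c x
  · have h1 := one_tmul_aeval_mem_of_root h hg
    have h2 : algebraMap Γ(X, U) P.localRing (aeval σ g) =
        aeval (X.presheaf.germ U P.pt hP σ) g :=
      (aeval_algHom_apply (X.presheaf.germ U P.pt hP).hom.toIntAlgHom σ g).symm
    rw [h2]
    exact h1

/-- A prime that divides `g(n)` exactly once, where `g` is an irreducible polynomial with a
critical value of `t` as a root, ramifies in the field generated by the fiber over `n`. -/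
theorem exists_ramifies_of_mem_finiteCriticalValues [IsIntegral X]
    (hπ : SmoothOfRelativeDimension 1 π) {t : X.functionField} (ht : Transcendental ℤ t)
    {a : Qbar} (ha : a ∈ finiteCriticalValues π t) {g : ℤ[X]} (hg : Irreducible g)
    (hdeg : g.natDegree ≠ 0) (hga : aeval a g = 0) :
    ∃ p₀ : ℕ, ∀ p : ℕ, p.Prime → p₀ ≤ p → ∀ n : ℕ, (p : ℤ) ∣ g.eval (n : ℤ) →
      ¬ (p : ℤ) ^ 2 ∣ g.eval (n : ℤ) → Ramifies p (fiberField π t n) := by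
  have : Algebra.IsAlgebraic ℚ Qbar := AlgebraicClosure.isAlgebraic ℚ
  have : Smooth π := SmoothOfRelativeDimension.smooth 1 π
  obtain ⟨P, s, hst, hs⟩ := ha
  obtain ⟨U, hU, hP, σ, rfl⟩ := exists_section_of_stalk s
  have : Nonempty U := ⟨⟨_, hP⟩⟩
  obtain ⟨f, hf⟩ := exists_ringHom_finiteType (π := π) hU
  let _ : Algebra ℚ Γ(X, U) := f.toAlgebra
  have : Algebra.FiniteType ℚ Γ(X, U) := hf
  let _ : Algebra ℚ X.functionField := ((X.germToFunctionField U).hom.comp f).toAlgebra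
  let ι : Γ(X, U) →ₐ[ℚ] X.functionField := ⟨(X.germToFunctionField U).hom, fun _ => rfl⟩
  have hι : Function.Injective ι := X.germToFunctionField_injective U
  have hσt : ι σ = t := by
    rw [← hst, Scheme.algebraMap_germ_eq_germToFunctionField]
    rfl
  have htQ : Transcendental ℚ t := fun h => ht ((IsFractionRing.isAlgebraic_iff ℤ ℚ _).2 h)
  have hσ : Transcendental ℚ σ := by
    rw [← hσt] at htQ
    exact fun h => htQ (h.algHom ι)
  have halg : ∀ y : Γ(X, U), ∃ Q : ℚ[X][X], Q ≠ 0 ∧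
      Q.eval₂ (aeval (R := ℚ) σ).toRingHom y = 0 := by
    intro y
    obtain ⟨Q, hQ0, hQ⟩ := exists_relation_functionField hπ htQ (ι y)
    refine ⟨Q, hQ0, hι ?_⟩
    have hcomp : (ι : Γ(X, U) →+* X.functionField).comp (aeval (R := ℚ) σ).toRingHom =
        (aeval t).toRingHom := by
      rw [← hσt]
      exact RingHom.ext fun q => (aeval_algHom_apply ι σ q).symm
    rw [map_zero, ← hQ, ← hcomp]
    exact hom_eval₂ Q _ (ι : Γ(X, U) →+* X.functionField) y
  let ev : Γ(X, U) →+* Qbar := P.eval.comp (X.presheaf.germ U P.pt hP).hom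
  have hmult : aeval σ g ∈ RingHom.ker ev ^ 2 := germ_aeval_mem_ker_sq hU f hP hs hga
  have heva : ev σ = a := by
    have h1 : P.geomEval ((1 : Qbar) ⊗ₜ[ℤ] (X.presheaf.germ U P.pt hP σ) -
        a ⊗ₜ[ℤ] (1 : P.localRing)) = 0 := Ideal.pow_le_self two_ne_zero hs
    have h2 : P.geomEval ((1 : Qbar) ⊗ₜ[ℤ] (X.presheaf.germ U P.pt hP σ)) = ev σ := by
      refine (Algebra.TensorProduct.lift_tmul _ _ _ _ _).trans ?_
      exact one_mul _
    have h3 : P.geomEval (a ⊗ₜ[ℤ] (1 : P.localRing)) = a := by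
      refine (Algebra.TensorProduct.lift_tmul _ _ _ _ _).trans ?_
      simp
    rwa [map_sub, h2, h3, sub_eq_zero] at h1
  obtain ⟨p₀, hp₀⟩ := exists_ringHom_ramifies hσ halg ev hg hdeg (by rwa [heva]) hmult
  refine ⟨p₀, fun p hp hpp n h1 h2 => ?_⟩
  obtain ⟨φ, hφ, hφK⟩ := hp₀ p hp hpp n h1 h2
  let Q : GeomPoint π := geomPointOfRingHom π hU φ
  have hQU : Q.pt ∈ U := geomPointOfRingHom_pt_mem hU φ
  have hQ : ∀ x, Q.eval (X.presheaf.germ U Q.pt hQU x) = φ x := geomPointOfRingHom_eval_germ hU φ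
  have hQn : Q ∈ fiber π t (n : Qbar) := by
    refine ⟨X.presheaf.germ U Q.pt hQU σ, ?_, ?_⟩
    · rw [Scheme.algebraMap_germ_eq_germToFunctionField]
      exact hσt
    · rw [hQ, hφ, Int.cast_natCast]
  refine hφK _ fun x => ?_
  have hle : Q.field ≤ fiberField π t n := le_iSup₂_of_le Q hQn le_rfl
  exact hle (IntermediateField.subset_adjoin _ _ ⟨_, hQ x⟩)

end

/-! ### Values divisible exactly once by given primes -/

section

open Polynomial

theorem exists_int_combination_of_separable_map {F : ℤ[X]}
    (hF : (F.map (Int.castRingHom ℚ)).Separable) :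
    ∃ (A B : ℤ[X]) (c : ℤ), c ≠ 0 ∧ A * F + B * derivative F = C c := by
  obtain ⟨u, v, huv⟩ := hF
  obtain ⟨b, hb, hb'⟩ := IsLocalization.integerNormalization_spec (nonZeroDivisors ℤ) u
  obtain ⟨d, hd, hd'⟩ := IsLocalization.integerNormalization_spec (nonZeroDivisors ℤ) v
  refine ⟨C d * IsLocalization.integerNormalization (nonZeroDivisors ℤ) u,
    C b * IsLocalization.integerNormalization (nonZeroDivisors ℤ) v, b * d,
    mul_ne_zero (nonZeroDivisors.ne_zero hb) (nonZeroDivisors.ne_zero hd), ?_⟩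
  apply Polynomial.map_injective (Int.castRingHom ℚ) Int.cast_injective
  rw [algebraMap_int_eq, zsmul_eq_mul] at hb' hd'
  rw [Polynomial.map_add, Polynomial.map_mul, Polynomial.map_mul, Polynomial.map_mul,
    Polynomial.map_mul, hb', hd', ← derivative_map]
  simp only [map_mul, eq_intCast, Polynomial.map_mul, Polynomial.map_intCast]
  linear_combination (b : ℚ[X]) * (d : ℚ[X]) * huv

/-- All roots of a separable polynomial modulo a large prime are simple. -/
theorem exists_dvd_derivative_eval_bound {F : ℤ[X]}
    (hF : (F.map (Int.castRingHom ℚ)).Separable) :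
    ∃ p₀ : ℕ, ∀ p : ℕ, p₀ ≤ p → ∀ x : ℤ, (p : ℤ) ∣ F.eval x →
      ¬ (p : ℤ) ∣ (derivative F).eval x := by
  obtain ⟨A, B, c, hc, h⟩ := exists_int_combination_of_separable_map hF
  refine ⟨c.natAbs + 1, fun p hp x h1 h2 => ?_⟩
  have h3 : A.eval x * F.eval x + B.eval x * (derivative F).eval x = c := by
    simpa using congrArg (eval x) h
  have h4 : (p : ℤ) ∣ c := h3 ▸ dvd_add (h1.mul_left _) (h2.mul_left _)
  have := Nat.le_of_dvd (Int.natAbs_pos.2 hc) (Int.natCast_dvd.1 h4)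
  omega

theorem dvd_eval_iff_of_modEq {F : ℤ[X]} {p x y : ℤ} (h : x ≡ y [ZMOD p]) :
    p ∣ F.eval x ↔ p ∣ F.eval y :=
  dvd_iff_dvd_of_dvd_sub (h.symm.dvd.trans (sub_dvd_eval_sub x y F))

/-- By the Chinese remainder theorem, roots modulo the primes dividing `m` are given by one
integer between `1` and `m`. -/
theorem exists_forall_prime_dvd_eval {F : ℤ[X]} {m : ℕ} (hm : m ≠ 0)
    (h : ∀ p : ℕ, p.Prime → p ∣ m → ∃ a : ℤ, (p : ℤ) ∣ F.eval a) :
    ∃ n : ℕ, 1 ≤ n ∧ n ≤ m ∧ ∀ p : ℕ, p.Prime → p ∣ m → (p : ℤ) ∣ F.eval (n : ℤ) := by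
  have h' : ∀ p : ℕ, ∃ a : ℕ, p.Prime → p ∣ m → (p : ℤ) ∣ F.eval (a : ℤ) := by
    intro p
    by_cases hp : p.Prime ∧ p ∣ m
    · obtain ⟨a, ha⟩ := h p hp.1 hp.2
      refine ⟨(a % p).toNat, fun _ _ => ?_⟩
      have hp0 : (p : ℤ) ≠ 0 := by exact_mod_cast hp.1.ne_zero
      rw [Int.toNat_of_nonneg (Int.emod_nonneg a hp0)]
      exact (dvd_eval_iff_of_modEq (Int.mod_modEq a p)).2 ha
    · exact ⟨0, fun h1 h2 => absurd ⟨h1, h2⟩ hp⟩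
  choose a ha using h'
  obtain ⟨k, hk⟩ := Nat.chineseRemainderOfFinset a id m.primeFactors
    (fun p hp => (Nat.prime_of_mem_primeFactors hp).ne_zero)
    (fun p hp q hq hpq => (Nat.coprime_primes (Nat.prime_of_mem_primeFactors hp)
      (Nat.prime_of_mem_primeFactors hq)).2 hpq)
  have hm0 := Nat.pos_of_ne_zero hm
  -- the representative of `k` modulo `m` between `1` and `m`
  refine ⟨(k + m - 1) % m + 1, by omega, Nat.mod_lt _ hm0, fun p hp hpm => ?_⟩
  have h1 : (k + m - 1) % m + 1 ≡ k [MOD m] := by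
    have := (Nat.mod_modEq (k + m - 1) m).add_right 1
    rw [show k + m - 1 + 1 = k + m by omega] at this
    exact this.trans (by simp [Nat.ModEq])
  have h2 := (h1.of_dvd hpm).trans (hk p (Nat.mem_primeFactors.2 ⟨hp, hpm, hm⟩))
  exact (dvd_eval_iff_of_modEq (Int.natCast_modEq_iff.2 h2)).2 (ha p hp hpm)

/-- If `x` is a simple root modulo `p` which is a root modulo `p ^ 2`, then no shift of `x` by an
integer `h` with `p ∥ h` is a root modulo `p ^ 2`. -/
theorem not_sq_dvd_eval_add {F : ℤ[X]} {p : ℕ} (hp : p.Prime) {x h : ℤ}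
    (hx : (p : ℤ) ^ 2 ∣ F.eval x) (hF : ¬ (p : ℤ) ∣ (derivative F).eval x) (hh : (p : ℤ) ∣ h)
    (hh2 : ¬ (p : ℤ) ^ 2 ∣ h) : ¬ (p : ℤ) ^ 2 ∣ F.eval (x + h) := by
  intro hxh
  obtain ⟨k, hk⟩ := F.binomExpansion x h
  have h1 : (p : ℤ) ^ 2 ∣ (derivative F).eval x * h := by
    have : (derivative F).eval x * h = F.eval (x + h) - F.eval x - k * h ^ 2 := by
      rw [hk]; ring
    rw [this]
    exact dvd_sub (dvd_sub hxh hx) ((pow_dvd_pow_of_dvd hh 2).mul_left k)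
  exact hh2 ((Nat.prime_iff_prime_int.1 hp).pow_dvd_of_dvd_mul_left 2 hF h1)

/-- There is `n ≤ m (ω(m) + 1)` such that every prime dividing `m` divides `F(n)` exactly once:
among the `ω(m) + 1` numbers `n₀ + j m`, where `n₀` is a common root modulo the primes dividing
`m`, each prime spoils at most one. -/
theorem exists_forall_prime_dvd_eval_not_sq_dvd {F : ℤ[X]} {m : ℕ} (hm : Squarefree m)
    (hω : m.primeFactors.card < m.minFac)
    (h : ∀ p : ℕ, p.Prime → p ∣ m → ∃ a : ℤ, (p : ℤ) ∣ F.eval a)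
    (hF : ∀ p : ℕ, p.Prime → p ∣ m → ∀ x : ℤ, (p : ℤ) ∣ F.eval x →
      ¬ (p : ℤ) ∣ (derivative F).eval x) :
    ∃ n : ℕ, 1 ≤ n ∧ n ≤ m * (m.primeFactors.card + 1) ∧ ∀ p : ℕ, p.Prime → p ∣ m →
      (p : ℤ) ∣ F.eval (n : ℤ) ∧ ¬ (p : ℤ) ^ 2 ∣ F.eval (n : ℤ) := by
  obtain ⟨n₀, h1, h2, h3⟩ := exists_forall_prime_dvd_eval hm.ne_zero h
  have h4 : ∀ j p : ℕ, p.Prime → p ∣ m → (p : ℤ) ∣ F.eval ((n₀ + j * m : ℕ) : ℤ) := by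
    intro j p hp hpm
    have : ((n₀ + j * m : ℕ) : ℤ) ≡ n₀ [ZMOD p] := by
      rw [Int.natCast_modEq_iff]
      have := (Nat.modEq_zero_iff_dvd.2 (hpm.mul_left j)).add_left n₀
      rwa [add_zero] at this
    exact (dvd_eval_iff_of_modEq this).2 (h3 p hp hpm)
  suffices ∃ j ∈ Finset.range (m.primeFactors.card + 1), ∀ p ∈ m.primeFactors,
      ¬ (p : ℤ) ^ 2 ∣ F.eval ((n₀ + j * m : ℕ) : ℤ) by
    obtain ⟨j, hj, hjp⟩ := this
    refine ⟨n₀ + j * m, by omega, ?_, fun p hp hpm =>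
      ⟨h4 j p hp hpm, hjp p (Nat.mem_primeFactors.2 ⟨hp, hpm, hm.ne_zero⟩)⟩⟩
    have : j * m ≤ m.primeFactors.card * m :=
      Nat.mul_le_mul_right m (Nat.lt_succ_iff.1 (Finset.mem_range.1 hj))
    calc n₀ + j * m ≤ m + m.primeFactors.card * m := add_le_add h2 this
      _ = _ := by ring
  -- otherwise two of the shifts are bad for the same prime
  by_contra! hbad
  choose! q hq hq2 using hbad
  obtain ⟨i, hi, j, hj, hij, hqij⟩ := Finset.exists_ne_map_eq_of_card_lt_of_maps_to
    (s := Finset.range (m.primeFactors.card + 1)) (t := m.primeFactors) (by simp) hq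
  wlog hlt : i < j generalizing i j
  · exact this j hj i hi hij.symm hqij.symm (by omega)
  have hqi := hq i hi
  obtain ⟨hp, hpm, -⟩ := Nat.mem_primeFactors.1 hqi
  have hpω : m.primeFactors.card < q i := hω.trans_le (Nat.minFac_le_of_dvd hp.two_le hpm)
  have hjω := Finset.mem_range.1 hj
  have h5 := hq2 j hj
  rw [← hqij] at h5
  refine not_sq_dvd_eval_add hp (hq2 i hi) (hF _ hp hpm _ (h4 i _ hp hpm))
    (h := ((j - i) * m : ℕ)) ?_ ?_ ?_
  · exact_mod_cast hpm.mul_left _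
  · intro hdvd
    have hdvd' : q i ^ 2 ∣ (j - i) * m := by exact_mod_cast hdvd
    have hnot : ¬ q i ∣ j - i := Nat.not_dvd_of_pos_of_lt (by omega) (by omega)
    have h6 := hp.prime.pow_dvd_of_dvd_mul_left 2 hnot hdvd'
    exact hp.one_lt.ne' (Nat.isUnit_iff.1 (hm _ (pow_two (q i) ▸ h6)))
  · have : ((n₀ + i * m : ℕ) : ℤ) + ((j - i) * m : ℕ) = ((n₀ + j * m : ℕ) : ℤ) := by
      rw [← Nat.cast_add, add_assoc, ← add_mul, Nat.add_sub_cancel' hlt.le]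
    rw [this]
    exact h5

variable {X : Scheme.{0}} {π : X ⟶ Spec (.of ℚ)}

/-- A large prime that divides `F(n)` exactly once ramifies in the field generated by the fiber
over `n`: it divides exactly once the value at `n` of some irreducible factor of `F`. -/
theorem exists_ramifies_of_isCriticalPolynomial [IsIntegral X]
    (hπ : SmoothOfRelativeDimension 1 π) {t : X.functionField} (ht : Transcendental ℤ t)
    {F : ℤ[X]} (hF : IsCriticalPolynomial π t F) :
    ∃ p₀ : ℕ, ∀ p : ℕ, p.Prime → p₀ ≤ p → ∀ n : ℕ, (p : ℤ) ∣ F.eval (n : ℤ) →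
      ¬ (p : ℤ) ^ 2 ∣ F.eval (n : ℤ) → Ramifies p (fiberField π t n) := by
  obtain ⟨f, hf, u, hfu⟩ := UniqueFactorizationMonoid.exists_prime_factors F hF.primitive.ne_zero
  have hdvd : ∀ g ∈ f, g ∣ F := fun g hg =>
    (Multiset.dvd_prod hg).trans ⟨u, hfu.symm⟩
  have key : ∀ g : ℤ[X], ∃ p₀ : ℕ, g ∈ f → ∀ p : ℕ, p.Prime → p₀ ≤ p → ∀ n : ℕ,
      (p : ℤ) ∣ g.eval (n : ℤ) → ¬ (p : ℤ) ^ 2 ∣ g.eval (n : ℤ) →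
      Ramifies p (fiberField π t n) := by
    intro g
    by_cases hg : g ∈ f
    swap
    · exact ⟨0, fun h => absurd h hg⟩
    -- `F` is primitive, so it has no constant irreducible factors
    have hdeg : g.natDegree ≠ 0 := by
      intro h
      obtain ⟨c, rfl⟩ := natDegree_eq_zero.1 h
      exact (hf _ hg).not_isUnit (isUnit_C.2 (hF.primitive c (hdvd _ hg)))
    obtain ⟨a, ha⟩ := IsAlgClosed.exists_aeval_eq_zero Qbar (g.map (algebraMap ℤ ℚ)) (by
      rw [degree_map_eq_of_injective (algebraMap ℤ ℚ).injective_int]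
      exact fun h => hdeg (natDegree_eq_of_degree_eq_some h))
    rw [aeval_map_algebraMap] at ha
    have haF : a ∈ finiteCriticalValues π t := by
      rw [← hF.roots]
      obtain ⟨q, hq⟩ := hdvd g hg
      change F.eval₂ (algebraMap ℤ Qbar) a = 0
      rw [← aeval_def, hq, map_mul, ha, zero_mul]
    obtain ⟨p₀, hp₀⟩ := exists_ramifies_of_mem_finiteCriticalValues hπ ht haF
      (hf g hg).irreducible hdeg ha
    exact ⟨p₀, fun _ => hp₀⟩
  choose N hN using key
  refine ⟨f.toFinset.sup N, fun p hp hpp n h1 h2 => ?_⟩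
  have h3 : (p : ℤ) ∣ (f.map fun g => g.eval (n : ℤ)).prod := by
    have : (u : ℤ[X]).eval (n : ℤ) * ((u⁻¹ : ℤ[X]ˣ) : ℤ[X]).eval (n : ℤ) = 1 := by
      rw [← eval_mul, Units.mul_inv, eval_one]
    rw [← eval_multiset_prod, ← mul_one (Polynomial.eval _ _), ← this, ← mul_assoc, ← eval_mul, hfu]
    exact h1.mul_right _
  obtain ⟨g, hg, hpg⟩ := (Nat.prime_iff_prime_int.1 hp).exists_mem_multiset_map_dvd h3
  refine hN g hg p hp ((Finset.le_sup (Multiset.mem_toFinset.2 hg)).trans hpp) n hpg fun h4 => h2 ?_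
  exact h4.trans (eval_dvd (hdvd g hg))

end

end Diversity

theorem mainTheorem7 (X : AlgebraicGeometry.Scheme.{0}) [AlgebraicGeometry.IsIntegral X]
    (π : X ⟶ AlgebraicGeometry.Spec (.of ℚ)) (hX : Diversity.IsCurve π)
    (t : X.functionField) (ht : Transcendental ℤ t)
    (F : Polynomial ℤ) (hF : Diversity.IsCriticalPolynomial π t F) :
    ∃ p₀ : ℕ, ∀ m ∈ Diversity.squarefreeSet F,
      (∀ p : ℕ, p.Prime → p ∣ m → p₀ ≤ p) →
      ArithmeticFunction.cardDistinctFactors m < m.minFac →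
      ∃ n : ℕ, 1 ≤ n ∧ n ≤ m * (ArithmeticFunction.cardDistinctFactors m + 1) ∧
        Diversity.IsPrimitiveFor π t m n := by
  classical
  obtain ⟨p₁, hp₁⟩ := Diversity.exists_ramifies_of_isCriticalPolynomial hX.smooth ht hF
  obtain ⟨p₂, hp₂⟩ := Diversity.exists_dvd_derivative_eval_bound hF.separable
  refine ⟨max p₁ p₂, fun m ⟨hm, hmF⟩ hmp hω => ?_⟩
  have hcard : ArithmeticFunction.cardDistinctFactors m = m.primeFactors.card := rfl
  rw [hcard] at hω ⊢
  obtain ⟨n, h1, hn, hpn⟩ := Diversity.exists_forall_prime_dvd_eval_not_sq_dvd hm hω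
    (fun p hp hpm => (hmF p hp hpm).2.1)
    fun p hp hpm => hp₂ p ((le_max_right _ _).trans (hmp p hp hpm))
  have hex : ∃ n : ℕ, 1 ≤ n ∧
      ∀ p : ℕ, p.Prime → p ∣ m → Diversity.Ramifies p (Diversity.fiberField π t n) :=
    ⟨n, h1, fun p hp hpm => hp₁ p hp ((le_max_left _ _).trans (hmp p hp hpm)) n
      (hpn p hp hpm).1 (hpn p hp hpm).2⟩
  -- primitivity for `n` is minimality of `n` among the integers with the ramification property
  refine ⟨Nat.find hex, (Nat.find_spec hex).1, le_trans (Nat.find_min' hex ⟨h1, ?_⟩) hn,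
    (Nat.find_spec hex).2, fun n' hn' hlt => ?_⟩
  · exact fun p hp hpm => hp₁ p hp ((le_max_left _ _).trans (hmp p hp hpm)) n
      (hpn p hp hpm).1 (hpn p hp hpm).2
  · have := Nat.find_min hex hlt
    push Not at this
    exact this hn'
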